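/- **Conventions.** For a group $G$ with a finite generating set $S$, $d_G$ is the word metric and $\Gamma_G$ the Cayley graph. For a subgroup $H\le G$, the coned-off Cayley graph $\widehat\Gamma_G(H)$ is obtained from $\Gamma_G$ by adding, for each left coset $gH$, a vertex $v(gH)$ and an edge of length $1/2$ from each element of $gH$ to $v(gH)$. $G$ is *weakly hyperbolic relative to $H$* if $\widehat\Gamma_G(H)$ is Gromov hyperbolic (for some finite generating set). An edge path in $\widehat\Gamma_G(H)$ is an *electric $P$-quasigeodesic* if each of its subpaths has length at most $P$ times the distance of its end points; it is *without backtracking* if it does not return to any left coset (with its cone point) after leaving it; it *penetrates* $gH$ if it passes through $v(gH)$. $G$ is *strongly hyperbolic relative to $H$* if, for some finite generating set, $\widehat\Gamma_G(H)$ is hyperbolic and $(G,H)$ has bounded coset penetration: for each $P\ge 1$ there is $D$ such that for any two electric $P$-quasigeodesics $\alpha,\beta$ without backtracking that have the same initial vertex and the same final vertex, both in $G$, and for every coset $gH$: (1) if $\alpha$ penetrates $gH$ and $\beta$ does not, then the points of $gH$ at which $\alpha$ first enters and last exits $gH$ are at $d_G$-distance at most $D$; (2) if both penetrate $gH$, then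 their first entry points are at $d_G$-distance at most $D$, and so are their last exit points. **Statement.** Let $$1\to (K,K_1)\to (G,N_G(K_1))\xrightarrow{\;p\;}(Q,Q_1)\to 1$$ be a short exact sequence of pairs of finitely generated groups, that is, $1\to K\to G\xrightarrow{p} Q\to1$ is a short exact sequence which restricts to a short exact sequence $1\to K_1\to N_G(K_1)\to Q_1\to 1$, where $K_1\le K$, $Q_1\le Q$ are subgroups and all six groups are finitely generated. Suppose that $K_1\ne K$, that $K$ is strongly hyperbolic relative to $K_1$, and that $G$ preserves cusps: for every $g\in G$ there is $k\in K$ with $gK_1g^{-1}=kK_1k^{-1}$. Then: 1. $Q_1=Q$. 2. There is a map $s\colon Q\to N_G(K_1)$ with $p\circ s=\mathrm{id}_Q$ which is a quasi-isometric embedding both for the word metric of $N_G(K_1)$ and for that of $G$: for any finite generating sets of $Q$, $N_G(K_1)$ and $G$ there are constants $R\ge1$, $\varepsilon\ge0$ such that for all $q,q'\in Q$ $$\tfrac1R d_Q(q,q')-\varepsilon\le d_{N_G(K_1)}(s(q),s(q'))\le R\,d_Q(q,q')+\varepsilon,$$ $$\tfrac1R d_Q(q,q')-\varepsilon\le d_{G}(s(q),s(q'))\le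 R\,d_Q(q,q')+\varepsilon.$$ 3. If in addition $G$ is weakly hyperbolic relative to $K_1$, then $Q$ is a hyperbolic group. -/

import Mathlib

noncomputable section

namespace RelHyp

/-- `S` is a finite generating set of the group `G`. -/
def IsFiniteGeneratingSet {G : Type*} [Group G] (S : Set G) : Prop :=
  S.Finite ∧ Subgroup.closure S = ⊤

/-- The word metric of `G` with respect to a generating set `S`: the combinatorial distance in the
Cayley graph, whose edges join `g` and `g * s` for `s ∈ S`. -/
def wordDist {G : Type*} [Group G] (S : Set G) (g h : G) : ℝ :=
  ((SimpleGraph.mulCayley S).dist g h : ℝ)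

/-- Gromov's four-point condition: `d` is `δ`-hyperbolic for some `δ ≥ 0`. For the vertex set of a
connected graph with its path metric this is the hyperbolicity of the graph. -/
def IsGromovHyperbolic {X : Type*} (d : X → X → ℝ) : Prop :=
  ∃ δ : ℝ, 0 ≤ δ ∧ ∀ x y z w : X, d x y + d z w ≤ max (d x z + d y w) (d x w + d y z) + 2 * δ

/-- A finitely generated group is hyperbolic if all its word metrics (for finite generating sets)
are hyperbolic. -/
def IsHyperbolicGroup (G : Type*) [Group G] : Prop :=
  Group.FG G ∧ ∀ S : Set G, IsFiniteGeneratingSet S → IsGromovHyperbolic (wordDist S)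

/-- `f` is an `(R, ε)`-quasi-isometric embedding for some `R ≥ 1` and `ε ≥ 0`. -/
def IsQuasiIsometricEmbedding {X Y : Type*} (dX : X → X → ℝ) (dY : Y → Y → ℝ) (f : X → Y) :
    Prop :=
  ∃ R ε : ℝ, 1 ≤ R ∧ 0 ≤ ε ∧ ∀ x x' : X,
    1 / R * dX x x' - ε ≤ dY (f x) (f x') ∧ dY (f x) (f x') ≤ R * dX x x' + ε

section ConedOff

variable {G : Type*} [Group G]

/-- The coned-off Cayley graph of `G` with respect to `H`: the Cayley graph with generators `S`
(vertices `inl g`), with an additional vertex `inr c` for each left coset `c` of `H`, joined to all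
elements of the coset. -/
def conedOffGraph (S : Set G) (H : Subgroup G) : SimpleGraph (G ⊕ G ⧸ H) where
  Adj
    | .inl g, .inl h => (SimpleGraph.mulCayley S).Adj g h
    | .inl g, .inr c => (g : G ⧸ H) = c
    | .inr c, .inl g => (g : G ⧸ H) = c
    | .inr _, .inr _ => False
  symm := by
    constructor
    rintro (g | c) (h | d) hab
    · exact hab.symm
    · exact hab
    · exact hab
    · exact hab
  loopless := by
    constructor
    rintro (g | c) hab
    · exact (SimpleGraph.mulCayley S).irrefl hab
    · exact hab

/-- Lengths of the edges of the coned-off graph: `1` for the edges of the Cayley graph and `1/2`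
for the edges that end in a cone point. -/
def edgeLength {H : Subgroup G} : G ⊕ G ⧸ H → G ⊕ G ⧸ H → ℝ
  | .inl _, .inl _ => 1
  | _, _ => 1 / 2

/-- The length of the part of an edge path between its `i`-th and its `j`-th vertex. -/
def segmentLength {S : Set G} {H : Subgroup G} {u v : G ⊕ G ⧸ H}
    (w : (conedOffGraph S H).Walk u v) (i j : ℕ) : ℝ :=
  ∑ k ∈ Finset.Ico i j, edgeLength (w.getVert k) (w.getVert (k + 1))

/-- The path metric on the vertices of the coned-off graph. -/
def conedOffDist (S : Set G) (H : Subgroup G) (u v : G ⊕ G ⧸ H) : ℝ :=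
  ⨅ w : (conedOffGraph S H).Walk u v, segmentLength w 0 w.length

/-- An electric `P`-quasigeodesic: the length of each subpath is at most `P` times the distance
of its end points. -/
def IsElectricQuasigeodesic (P : ℝ) {S : Set G} {H : Subgroup G} {u v : G ⊕ G ⧸ H}
    (w : (conedOffGraph S H).Walk u v) : Prop :=
  ∀ i j : ℕ, i ≤ j → j ≤ w.length →
    segmentLength w i j ≤ P * conedOffDist S H (w.getVert i) (w.getVert j)

/-- A vertex lies in the (coned) coset `c` if it is an element of `c` or the cone point of `c`. -/
def InConedCoset {H : Subgroup G} (c : G ⧸ H) : G ⊕ G ⧸ H → Prop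
  | .inl g => (g : G ⧸ H) = c
  | .inr d => d = c

/-- A path is without backtracking if it does not return to any left coset after leaving it. -/
def IsWithoutBacktracking {S : Set G} {H : Subgroup G} {u v : G ⊕ G ⧸ H}
    (w : (conedOffGraph S H).Walk u v) : Prop :=
  ∀ (c : G ⧸ H) (i j k : ℕ), i ≤ j → j ≤ k → k ≤ w.length →
    InConedCoset c (w.getVert i) → InConedCoset c (w.getVert k) → InConedCoset c (w.getVert j)

/-- A path penetrates a left coset if it passes through the cone point of the coset. -/
def Penetrates {S : Set G} {H : Subgroup G} {u v : G ⊕ G ⧸ H}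
    (w : (conedOffGraph S H).Walk u v) (c : G ⧸ H) : Prop :=
  Sum.inr c ∈ w.support

/-- `g` is the vertex of the Cayley graph at which the path first enters the left coset `c`. -/
def IsFirstEntry {S : Set G} {H : Subgroup G} {u v : G ⊕ G ⧸ H}
    (w : (conedOffGraph S H).Walk u v) (c : G ⧸ H) (g : G) : Prop :=
  (g : G ⧸ H) = c ∧ ∃ i ≤ w.length, w.getVert i = Sum.inl g ∧
    ∀ j < i, ¬ InConedCoset c (w.getVert j)

/-- `g` is the vertex of the Cayley graph at which the path last exits the left coset `c`. -/
def IsLastExit {S : Set G} {H : Subgroup G} {u v : G ⊕ G ⧸ H}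
    (w : (conedOffGraph S H).Walk u v) (c : G ⧸ H) (g : G) : Prop :=
  (g : G ⧸ H) = c ∧ ∃ i ≤ w.length, w.getVert i = Sum.inl g ∧
    ∀ j, i < j → j ≤ w.length → ¬ InConedCoset c (w.getVert j)

/-- Farb's bounded coset penetration property of the pair `(G, H)`, for the Cayley graph with
generators `S`. The paths start and end at vertices of the Cayley graph. -/
def BoundedCosetPenetration (S : Set G) (H : Subgroup G) : Prop :=
  ∀ P : ℝ, 1 ≤ P → ∃ D : ℝ, ∀ (x y : G)
    (α β : (conedOffGraph S H).Walk (Sum.inl x) (Sum.inl y)),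
    IsElectricQuasigeodesic P α → IsWithoutBacktracking α →
    IsElectricQuasigeodesic P β → IsWithoutBacktracking β →
    ∀ c : G ⧸ H,
      (Penetrates α c → ¬ Penetrates β c →
        ∀ a b : G, IsFirstEntry α c a → IsLastExit α c b → wordDist S a b ≤ D) ∧
      (Penetrates α c → Penetrates β c →
        (∀ a b : G, IsFirstEntry α c a → IsFirstEntry β c b → wordDist S a b ≤ D) ∧
        (∀ a b : G, IsLastExit α c a → IsLastExit β c b → wordDist S a b ≤ D))

/-- `G` is weakly hyperbolic relative to `H`: the coned-off Cayley graph is hyperbolic. -/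
def IsWeaklyHyperbolicRel (H : Subgroup G) : Prop :=
  ∃ S : Set G, IsFiniteGeneratingSet S ∧ IsGromovHyperbolic (conedOffDist S H)

/-- `G` is strongly hyperbolic relative to `H` in the sense of Farb. -/
def IsStronglyHyperbolicRel (H : Subgroup G) : Prop :=
  ∃ S : Set G, IsFiniteGeneratingSet S ∧ IsGromovHyperbolic (conedOffDist S H) ∧
    BoundedCosetPenetration S H

end ConedOff

section Extensions

variable {K G Q : Type*} [Group K] [Group G] [Group Q]

/-- `1 → (K, K₁) → (G, G₁) → (Q, Q₁) → 1` is a short exact sequence of pairs: besides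
`1 → K → G → Q → 1`, which is `E`, also the restriction `1 → K₁ → G₁ → Q₁ → 1` is defined and
exact. -/
structure IsExactOnPairs (E : GroupExtension K G Q) (K₁ : Subgroup K) (G₁ : Subgroup G)
    (Q₁ : Subgroup Q) : Prop where
  map_inl : K₁.map E.inl = G₁ ⊓ E.rightHom.ker
  map_rightHom : G₁.map E.rightHom = Q₁

/-- `G` preserves cusps: each `G`-conjugate of `K₁` is a `K`-conjugate of `K₁`. -/
def PreservesCusps (E : GroupExtension K G Q) (K₁ : Subgroup K) : Prop :=
  ∀ g : G, ∃ k : K, (K₁.map E.inl).map (MulAut.conj g).toMonoidHom =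
    (K₁.map E.inl).map (MulAut.conj (E.inl k)).toMonoidHom

/-- The normalizer in `G` of the subgroup `K₁` of the kernel. -/
abbrev cuspNormalizer (E : GroupExtension K G Q) (K₁ : Subgroup K) : Subgroup G :=
  Subgroup.normalizer (K₁.map E.inl : Set G)

end Extensions

end RelHyp

end

/-! If $gK_1g^{-1}=kK_1k^{-1}$, then $k^{-1}g$ normalizes $K_1$ and has the same image in $Q$ as
$g$. Hence $N_G(K_1)$ maps onto $Q$, which is $Q_1=Q$. Two lifts of one element to the normalizer
differ by an element of $K_1$, because $N_G(K_1)\cap K=K_1$; the task is to choose among them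
coherently.

Fix $k_0\notin K_1$. A lift $g$ acts on $K$ by an automorphism preserving $K_1$ and moves $k_0K_1$
to another coset. Take a geodesic of the coned-off graph from the cone point of $K_1$ to that of the
moved coset; it exits $K_1$ at some $h$, and replacing $g$ by $h^{-1}g$ moves the exit to $1$. Let
$t(q)$ be a lift normalized in this way. If $\alpha$ is a fixed lift of $a$, then $t(ax)=h\alpha
t(x)$ with $h\in K_1$, and $h^{-1}$ is an exit point towards the $\alpha$-image of a coset whose
exit point is $1$. So $h$ ranges over a finite set once an automorphism preserving $K_1$ is known to
displace exit points by a bounded amount (`exists_wordDist_le_of_exit`).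

For that bound, the automorphism is a quasi-isometry of the coned-off graph. By stability of
quasigeodesics, the image of the old geodesic fellow travels the new one. Following the image for a
bounded time, crossing over and returning along the new geodesic joins the two exit points by a path
of bounded length that misses the cone point of $K_1$. Bounded coset penetration makes such points
close in the word metric (`BoundedCosetPenetration.exists_wordDist_le_of_avoiding`).

Consequently $s(q)=t(q^{-1})^{-1}$ is Lipschitz, and it is a quasi-isometric embedding since $p$ is
Lipschitz too. As $p$ also descends to the graph of $G$ coned off along $K_1\le\ker p$, the section
embeds $Q$ quasi-isometrically there, and hyperbolicity passes to $Q$. -/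

noncomputable section

namespace RelHyp

/-! ### Discrete geodesics, Gromov products and the four-point condition -/

section Hyperbolicity

variable {X : Type*}

/-- A sequence `f 0, …, f n` of steps of lengths between `1/2` and `1` that realizes the
distances of its members. -/
structure IsDiscreteGeodesic (d : X → X → ℝ) (n : ℕ) (f : ℕ → X) : Prop where
  add : ∀ i j k, i ≤ j → j ≤ k → k ≤ n → d (f i) (f j) + d (f j) (f k) = d (f i) (f k)
  le_step : ∀ i < n, 1 / 2 ≤ d (f i) (f (i + 1))
  step_le : ∀ i < n, d (f i) (f (i + 1)) ≤ 1

/-- A pseudometric in which any two points are joined by a discrete geodesic. -/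
structure IsDiscreteGeodesicMetric (d : X → X → ℝ) : Prop where
  self : ∀ x, d x x = 0
  comm : ∀ x y, d x y = d y x
  triangle : ∀ x y z, d x z ≤ d x y + d y z
  exists_geodesic : ∀ x y, ∃ n f, f 0 = x ∧ f n = y ∧ IsDiscreteGeodesic d n f

/-- Gromov's four-point condition with constant `δ`. -/
def FourPoint (d : X → X → ℝ) (δ : ℝ) : Prop :=
  ∀ x y z w : X, d x y + d z w ≤ max (d x z + d y w) (d x w + d y z) + 2 * δ

/-- The Gromov product of `x` and `y` with respect to `w`. -/
def gromovProduct (d : X → X → ℝ) (w x y : X) : ℝ := (d w x + d w y - d x y) / 2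

/-- A sequence `f 0, …, f n` that is a quasigeodesic with multiplicative and additive
constants `R`. -/
structure IsQuasigeodesicSeq (d : X → X → ℝ) (R : ℝ) (n : ℕ) (f : ℕ → X) : Prop where
  le : ∀ i j, i ≤ j → j ≤ n → d (f i) (f j) ≤ R * ((j : ℝ) - i) + R
  ge : ∀ i j, i ≤ j → j ≤ n → (j : ℝ) - i ≤ R * d (f i) (f j) + R

variable {d : X → X → ℝ}

namespace IsDiscreteGeodesicMetric

theorem nonneg (hd : IsDiscreteGeodesicMetric d) (x y : X) : 0 ≤ d x y := by
  have h1 := hd.triangle x y x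
  rw [hd.self, hd.comm y x] at h1
  linarith

theorem gromovProduct_nonneg (hd : IsDiscreteGeodesicMetric d) (w x y : X) :
    0 ≤ gromovProduct d w x y := by
  have h1 := hd.triangle x w y
  rw [hd.comm x w] at h1
  unfold gromovProduct
  linarith

end IsDiscreteGeodesicMetric

theorem IsDiscreteGeodesic.dist_le {n : ℕ} {f : ℕ → X} (hd : IsDiscreteGeodesicMetric d)
    (hf : IsDiscreteGeodesic d n f) :
    ∀ i j, i ≤ j → j ≤ n → d (f i) (f j) ≤ (j : ℝ) - i := by
  intro i j hij
  induction j, hij using Nat.le_induction with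
  | base => intro _; simp [hd.self]
  | succ j hij ih =>
    intro hj
    have h1 := ih (by omega)
    have h2 := hf.add i j (j + 1) hij (by omega) hj
    have h3 := hf.step_le j (by omega)
    push_cast
    linarith

theorem IsDiscreteGeodesic.le_dist {n : ℕ} {f : ℕ → X} (hd : IsDiscreteGeodesicMetric d)
    (hf : IsDiscreteGeodesic d n f) :
    ∀ i j, i ≤ j → j ≤ n → ((j : ℝ) - i) / 2 ≤ d (f i) (f j) := by
  intro i j hij
  induction j, hij using Nat.le_induction with
  | base => intro _; simp [hd.self]
  | succ j hij ih =>
    intro hj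
    have h1 := ih (by omega)
    have h2 := hf.add i j (j + 1) hij (by omega) hj
    have h3 := hf.le_step j (by omega)
    push_cast
    linarith

/-- A point of a geodesic from `x` to `y` at approximately given distance from `x`. -/
theorem IsDiscreteGeodesicMetric.exists_between (hd : IsDiscreteGeodesicMetric d) (x y : X)
    {r : ℝ} (hr : 0 ≤ r) (hr' : r ≤ d x y) :
    ∃ w, d x w + d w y = d x y ∧ r ≤ d x w ∧ d x w ≤ r + 1 := by
  classical
  obtain ⟨n, f, rfl, rfl, hf⟩ := hd.exists_geodesic x y
  have hex : ∃ i, i ≤ n ∧ r ≤ d (f 0) (f i) := ⟨n, le_rfl, hr'⟩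
  obtain ⟨h1, h2⟩ := Nat.find_spec hex
  have hmin : ∀ {m}, m < Nat.find hex → _ := fun {m} => Nat.find_min hex (m := m)
  generalize Nat.find hex = i at h1 h2 hmin
  refine ⟨f i, hf.add 0 i n (by omega) h1 le_rfl, h2, ?_⟩
  rcases i with _ | i
  · rw [hd.self]; linarith
  · have h3 : d (f 0) (f i) < r := by
      by_contra hcon
      exact hmin (Nat.lt_succ_self i) ⟨by omega, not_lt.1 hcon⟩
    have h4 := hf.add 0 i (i + 1) (by omega) (by omega) h1
    have h5 := hf.step_le i (by omega)
    linarith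

/-- The four-point condition for `x`, `y`, `z`, `w`, rewritten with Gromov products based at `w`;
this is the form that can be iterated. -/
theorem FourPoint.min_gromovProduct_le {δ : ℝ} (hd : IsDiscreteGeodesicMetric d)
    (h : FourPoint d δ) (w x y z : X) :
    min (gromovProduct d w x z) (gromovProduct d w z y) - δ ≤ gromovProduct d w x y := by
  have h1 := h x y z w
  have e1 := hd.comm x w
  have e2 := hd.comm y w
  have e3 := hd.comm z w
  have e4 := hd.comm y z
  unfold gromovProduct
  rcases le_total (d x z + d y w) (d x w + d y z) with h2 | h2
  · rw [max_eq_right h2] at h1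
    have := min_le_right ((d w x + d w z - d x z) / 2) ((d w z + d w y - d z y) / 2)
    linarith
  · rw [max_eq_left h2] at h1
    have := min_le_left ((d w x + d w z - d x z) / 2) ((d w z + d w y - d z y) / 2)
    linarith

/-- Halving the chain costs one `δ` per halving, so the loss is only logarithmic in the number of
steps. This is the source of the exponential divergence used for quasigeodesics. -/
theorem FourPoint.le_gromovProduct_of_chain {δ : ℝ} (hd : IsDiscreteGeodesicMetric d)
    (hδ : 0 ≤ δ) (h : FourPoint d δ) (w : X) (f : ℕ → X) (m : ℝ) :
    ∀ k i j : ℕ, i < j → j - i ≤ 2 ^ k →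
      (∀ t, i ≤ t → t < j → m ≤ gromovProduct d w (f t) (f (t + 1))) →
      m - k * δ ≤ gromovProduct d w (f i) (f j) := by
  intro k
  induction k with
  | zero =>
    intro i j hij hk ht
    obtain rfl : j = i + 1 := by simp at hk; omega
    simpa using ht i le_rfl hij
  | succ k ih =>
    intro i j hij hk ht
    by_cases hs : j - i ≤ 2 ^ k
    · have := ih i j hij hs ht
      push_cast
      linarith
    · have hp : 0 < 2 ^ k := by positivity
      rw [pow_succ] at hk
      have h1 := ih i (i + 2 ^ k) (by omega) (by omega) (fun t h1 h2 => ht t h1 (by omega))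
      have h2 := ih (i + 2 ^ k) j (by omega) (by omega) (fun t h1 h2 => ht t (by omega) h2)
      have h3 := h.min_gromovProduct_le hd w (f i) (f j) (f (i + 2 ^ k))
      have h4 := le_min h1 h2
      push_cast
      linarith

/-- A point with small Gromov product of `a` and `c` is close to a geodesic from `a` to `c`. -/
theorem FourPoint.exists_between_near {δ : ℝ} (hd : IsDiscreteGeodesicMetric d)
    (h : FourPoint d δ) (p a c : X) :
    ∃ r, d a r + d r c = d a c ∧ d p r ≤ gromovProduct d p a c + 2 * δ + 1 := by
  have hr : 0 ≤ gromovProduct d a p c := hd.gromovProduct_nonneg a p c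
  have hr' : gromovProduct d a p c ≤ d a c := by
    have := hd.triangle a c p
    have := hd.comm c p
    unfold gromovProduct
    linarith
  obtain ⟨r, h1, h2, h3⟩ := hd.exists_between a c hr hr'
  refine ⟨r, h1, ?_⟩
  have h4 := h p r a c
  have e1 := hd.comm p a
  have e2 := hd.comm r a
  unfold gromovProduct at *
  have h5 : max (d p a + d r c) (d p c + d r a) ≤ (d a p + d a c + d p c) / 2 + 1 := by
    apply max_le <;> linarith
  linarith

/-- Points between `x` and `y` at similar distances from `x` are close. -/
theorem FourPoint.dist_between_le {δ : ℝ} (hd : IsDiscreteGeodesicMetric d)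
    (h : FourPoint d δ) {x y w w' : X} (hw : d x w + d w y = d x y)
    (hw' : d x w' + d w' y = d x y) : d w w' ≤ |d x w - d x w'| + 2 * δ := by
  have h1 := h w w' x y
  have e1 := hd.comm w x
  have e2 := hd.comm w' x
  have a1 := le_abs_self (d x w - d x w')
  have a2 := neg_abs_le (d x w - d x w')
  have h5 : max (d w x + d w' y) (d w y + d w' x) ≤ d x y + |d x w - d x w'| := by
    apply max_le <;> linarith
  linarith

theorem exists_linear_le_two_pow (a b : ℝ) : ∃ K : ℕ, ∀ k : ℕ, K ≤ k → a * k + b ≤ 2 ^ k := by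
  have h1 : Filter.Tendsto (fun n : ℕ => a * ((n : ℝ) ^ 1 * (1 / 2 : ℝ) ^ n)
      + b * ((n : ℝ) ^ 0 * (1 / 2 : ℝ) ^ n)) Filter.atTop (nhds (a * 0 + b * 0)) :=
    ((tendsto_pow_const_mul_const_pow_of_abs_lt_one 1 (by norm_num [abs_lt])).const_mul a).add
      ((tendsto_pow_const_mul_const_pow_of_abs_lt_one 0 (by norm_num [abs_lt])).const_mul b)
  have h2 : ∀ᶠ n : ℕ in Filter.atTop, a * ((n : ℝ) ^ 1 * (1 / 2 : ℝ) ^ n)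
      + b * ((n : ℝ) ^ 0 * (1 / 2 : ℝ) ^ n) < 1 := h1.eventually_lt_const (by norm_num)
  obtain ⟨K, hK⟩ := Filter.eventually_atTop.1 h2
  refine ⟨K, fun k hk => ?_⟩
  have h3 := hK k hk
  have h4 : (0 : ℝ) < 2 ^ k := by positivity
  have h5 : (1 / 2 : ℝ) ^ k * 2 ^ k = 1 := by rw [← mul_pow]; norm_num
  have h6 := mul_lt_mul_of_pos_right h3 h4
  have h7 : (a * ((k : ℝ) ^ 1 * (1 / 2 : ℝ) ^ k) + b * ((k : ℝ) ^ 0 * (1 / 2 : ℝ) ^ k)) * 2 ^ k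
      = (a * k + b) * ((1 / 2 : ℝ) ^ k * 2 ^ k) := by ring
  rw [h7, h5] at h6
  linarith

/-- A linear function of `B` is bounded by `2 ^ k` with `k` at most a small multiple of `B`. -/
theorem exists_log_bound (δ a b c : ℝ) (hδ : 0 ≤ δ) : ∃ B₀ : ℝ, 0 ≤ B₀ ∧ ∀ B, B₀ ≤ B →
    ∃ k : ℕ, a * B + b ≤ 2 ^ k ∧ k * δ + c < B := by
  obtain ⟨K, hK⟩ := exists_linear_le_two_pow (|a| * (δ + 1)) (|a| * (|c| + 2 * (δ + 1)) + |b|)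
  refine ⟨|c| + (K + 2) * (δ + 1), by positivity, fun B hB => ?_⟩
  have hδ' : 0 < δ + 1 := by linarith
  -- `k` grows linearly in `B` with slope `1 / (δ + 1)`, so `k * δ` stays below `B` while `2 ^ k`
  -- beats any linear function. The denominator `δ + 1` is positive even when `δ = 0`.
  set t := (B - |c|) / (δ + 1) with ht
  have htB : t * (δ + 1) = B - |c| := by rw [ht]; field_simp
  have htK : (K : ℝ) + 2 ≤ t := by
    rw [ht, le_div_iff₀ hδ']; linarith
  have hK0 : (0 : ℝ) ≤ K := Nat.cast_nonneg K
  refine ⟨⌊t⌋₊ - 1, ?_, ?_⟩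
  · have h1 : K ≤ ⌊t⌋₊ - 1 := by
      have : K + 2 ≤ ⌊t⌋₊ := Nat.le_floor (by push_cast; exact htK)
      omega
    have h2 := hK _ h1
    have h3 : t < ((⌊t⌋₊ - 1 : ℕ) : ℝ) + 2 := by
      have h4 := Nat.lt_floor_add_one t
      have h5 : 1 ≤ ⌊t⌋₊ := by
        have : K + 2 ≤ ⌊t⌋₊ := Nat.le_floor (by push_cast; exact htK)
        omega
      rw [Nat.cast_sub h5]
      push_cast
      linarith
    refine le_trans ?_ h2
    have hB' : B ≤ (δ + 1) * ((⌊t⌋₊ - 1 : ℕ) : ℝ) + (|c| + 2 * (δ + 1)) := by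
      nlinarith
    have hB0 : 0 ≤ B := by have := abs_nonneg c; nlinarith
    have h6 : a * B ≤ |a| * B := mul_le_mul_of_nonneg_right (le_abs_self a) hB0
    have h7 := mul_le_mul_of_nonneg_left hB' (abs_nonneg a)
    have h8 := le_abs_self b
    nlinarith
  · have h5 : 1 ≤ ⌊t⌋₊ := by
      have : K + 2 ≤ ⌊t⌋₊ := Nat.le_floor (by push_cast; exact htK)
      omega
    rw [Nat.cast_sub h5]
    have h6 := Nat.floor_le (show 0 ≤ t by linarith)
    have h7 := le_abs_self c
    push_cast
    nlinarith

end Hyperbolicity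

/-! ### Stability of quasigeodesics and invariance of hyperbolicity -/

section Morse

variable {X : Type*} {d : X → X → ℝ}

theorem gromovProduct_comm (hd : IsDiscreteGeodesicMetric d) (w x y : X) :
    gromovProduct d w x y = gromovProduct d w y x := by
  unfold gromovProduct
  rw [hd.comm x y]
  ring

theorem gromovProduct_le_dist_between (hd : IsDiscreteGeodesicMetric d) {w x y p : X}
    (hp : d x p + d p y = d x y) : gromovProduct d w x y ≤ d w p := by
  have h1 := hd.triangle w p x
  have h2 := hd.triangle w p y
  have h3 := hd.comm p x
  unfold gromovProduct
  linarith

/-- Points on a geodesic are uniformly close to each quasigeodesic with the same end points. -/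
theorem FourPoint.exists_geodesic_near_quasigeodesic {δ R : ℝ} (hd : IsDiscreteGeodesicMetric d)
    (hδ : 0 ≤ δ) (h : FourPoint d δ) (hR : 1 ≤ R) :
    ∃ D : ℝ, 0 ≤ D ∧ ∀ (n : ℕ) (f : ℕ → X), IsQuasigeodesicSeq d R n f →
      ∀ w, d (f 0) w + d w (f n) = d (f 0) (f n) → ∃ i ≤ n, d w (f i) ≤ D := by
  -- The parameter interval between the two points of `f` chosen below has length at most `R * (6 *
  -- B + 2) + R`; the last argument collects the losses that the final contradiction must absorb.
  obtain ⟨B₀, hB₀, hB⟩ := exists_log_bound δ (6 * R) (3 * R) (1 + R + 2 * δ) hδ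
  refine ⟨B₀, hB₀, fun n f hf => ?_⟩
  -- Descent on the bound: as long as it exceeds `B₀`, the bound `B` valid for all geodesic points
  -- improves to `B - 1`. It starts from a crude bound depending on `f`.
  have step : ∀ m : ℕ, (∀ w, d (f 0) w + d w (f n) = d (f 0) (f n) →
      ∃ i ≤ n, d w (f i) ≤ B₀ + m) →
      ∀ w, d (f 0) w + d w (f n) = d (f 0) (f n) → ∃ i ≤ n, d w (f i) ≤ B₀ := by
    intro m
    induction m with
    | zero => intro hm; simpa using hm
    | succ m ih =>
      intro hm
      refine ih fun w hw => ?_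
      by_contra! hcon
      set B : ℝ := B₀ + (m + 1 : ℕ) with hBdef
      have hBm : B - 1 = B₀ + m := by rw [hBdef]; push_cast; ring
      have hB1 : 0 ≤ B := by positivity
      rw [← hBm] at hcon
      obtain ⟨k, hk1, hk2⟩ := hB B (by rw [hBdef]; simp; positivity)
      -- On each side of `w`, take a geodesic point at distance about `2 * B`, or the end point if
      -- that is nearer. It lies within `B` of the quasigeodesic, so passing over to the
      -- quasigeodesic there stays far from `w`.
      have side : ∀ e ≤ n, (∀ y, d w y + d y (f e) = d w (f e) →
          d (f 0) y + d y (f n) = d (f 0) (f n)) →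
          ∃ y, ∃ i ≤ n, d w y + d y (f e) = d w (f e) ∧ d y (f i) ≤ B ∧ d w y ≤ 2 * B + 1 ∧
            B - 1 ≤ gromovProduct d w y (f i) := by
        intro e he hbet
        rcases le_total (d w (f e)) (2 * B) with hle | hle
        · refine ⟨f e, e, he, ?_, ?_, by linarith, ?_⟩
          · rw [hd.self]; ring
          · rw [hd.self]; exact hB1
          · have := hcon e he
            unfold gromovProduct
            rw [hd.self]
            linarith
        · obtain ⟨y, h1, h2, h3⟩ := hd.exists_between w (f e) (by linarith) hle
          obtain ⟨i, hi, hyi⟩ := hm y (hbet y h1)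
          refine ⟨y, i, hi, h1, hyi, h3, ?_⟩
          have := hcon i hi
          unfold gromovProduct
          linarith
      obtain ⟨y, i, hi, hy1, hy2, hy3, hy4⟩ := side 0 (Nat.zero_le _) (by
        intro y hy
        have a1 := hd.triangle (f 0) y (f n)
        have a2 := hd.triangle y w (f n)
        have a3 := hd.comm y (f 0)
        have a4 := hd.comm y w
        have a5 := hd.comm (f 0) w
        linarith)
      obtain ⟨z, j, hj, hz1, hz2, hz3, hz4⟩ := side n le_rfl (by
        intro y hy
        have a1 := hd.triangle (f 0) y (f n)
        have a2 := hd.triangle (f 0) w y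
        linarith)
      -- `w` lies between `y` and `z`, whereas the chain from `y` to `z` along the quasigeodesic
      -- stays away from `w` and forces this product to be positive.
      have hyz : gromovProduct d w y z ≤ 0 := by
        have a1 := hd.triangle (f 0) y (f n)
        have a2 := hd.triangle y z (f n)
        have a3 := hd.comm y (f 0)
        have a4 := hd.comm (f 0) w
        unfold gromovProduct
        linarith
      have hij : d (f i) (f j) ≤ 6 * B + 2 := by
        have a1 := hd.triangle (f i) y (f j)
        have a2 := hd.triangle y w (f j)
        have a3 := hd.triangle w z (f j)
        have a4 := hd.comm (f i) y
        have a5 := hd.comm y w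
        linarith
      have key : ∀ i j, i < j → j ≤ n → d (f i) (f j) ≤ 6 * B + 2 →
          B - 1 - R - k * δ ≤ gromovProduct d w (f i) (f j) := by
        intro i j hij hj hdist
        apply h.le_gromovProduct_of_chain hd hδ w f _ k i j hij
        · have h1 := hf.ge i j hij.le hj
          have h2 : R * d (f i) (f j) ≤ R * (6 * B + 2) :=
            mul_le_mul_of_nonneg_left hdist (by linarith)
          have h3 : ((j - i : ℕ) : ℝ) ≤ 2 ^ k := by
            rw [Nat.cast_sub hij.le]
            nlinarith
          exact_mod_cast h3
        · intro t ht1 ht2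
          have h1 := hf.le t (t + 1) (by omega) (by omega)
          have h2 := hcon t (by omega)
          have h3 := hcon (t + 1) (by omega)
          push_cast at h1
          unfold gromovProduct
          linarith
      have hkδ : 0 ≤ k * δ := by positivity
      have hmid : B - 1 - R - k * δ ≤ gromovProduct d w (f i) (f j) := by
        rcases lt_trichotomy i j with hlt | rfl | hlt
        · exact key i j hlt hj hij
        · have := hcon i hi
          unfold gromovProduct
          rw [hd.self]
          linarith
        · rw [gromovProduct_comm hd]
          exact key j i hlt hi (by rw [hd.comm]; exact hij)
      have h1 := h.min_gromovProduct_le hd w y z (f i)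
      have h2 := h.min_gromovProduct_le hd w (f i) z (f j)
      have h3 : B - 1 - R - k * δ ≤ gromovProduct d w (f j) z := by
        rw [gromovProduct_comm hd]; linarith
      have h4 := le_min hmid h3
      have h5 : B - 1 - R - k * δ - δ ≤ gromovProduct d w (f i) z := by linarith
      have h6 := le_min (show B - 1 - R - k * δ - δ ≤ gromovProduct d w y (f i) by linarith) h5
      linarith
  refine step ⌈d (f 0) (f n)⌉₊ fun w hw => ⟨0, Nat.zero_le _, ?_⟩
  have h1 := Nat.le_ceil (d (f 0) (f n))
  have h2 := hd.nonneg w (f n)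
  rw [hd.comm]
  linarith

/-- Quasigeodesics are uniformly close to each geodesic with the same end points. -/
theorem FourPoint.exists_gromovProduct_quasigeodesic_le {δ R : ℝ}
    (hd : IsDiscreteGeodesicMetric d) (hδ : 0 ≤ δ) (h : FourPoint d δ) (hR : 1 ≤ R) :
    ∃ C : ℝ, 0 ≤ C ∧ ∀ (n : ℕ) (f : ℕ → X), IsQuasigeodesicSeq d R n f →
      ∀ i ≤ n, gromovProduct d (f i) (f 0) (f n) ≤ C := by
  obtain ⟨D, hD, hnear⟩ := h.exists_geodesic_near_quasigeodesic hd hδ hR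
  set M : ℝ := 2 * (D + 1) + 3 + 2 * δ with hM
  refine ⟨R * (R * M + R) + R + (D + 1), by positivity, fun n f hf i hi => ?_⟩
  have hw : ∀ r : ℕ, ∃ w, d (f 0) w + d w (f n) = d (f 0) (f n) ∧
      min (r : ℝ) (d (f 0) (f n)) ≤ d (f 0) w ∧ d (f 0) w ≤ min (r : ℝ) (d (f 0) (f n)) + 1 :=
    fun r => hd.exists_between _ _ (le_min (Nat.cast_nonneg r) (hd.nonneg _ _)) (min_le_right _ _)
  choose w hw1 hw2 hw3 using hw
  have hclose : ∀ r, d (w r) (w (r + 1)) ≤ 3 + 2 * δ := by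
    intro r
    refine (h.dist_between_le hd (hw1 r) (hw1 (r + 1))).trans ?_
    have h1 : |d (f 0) (w r) - d (f 0) (w (r + 1))| ≤ 2 := by
      have a1 := hw2 r
      have a2 := hw3 r
      have a3 := hw2 (r + 1)
      have a4 := hw3 (r + 1)
      have a5 : min (r : ℝ) (d (f 0) (f n)) ≤ min ((r + 1 : ℕ) : ℝ) (d (f 0) (f n)) :=
        min_le_min_right _ (by push_cast; linarith)
      have a6 : min ((r + 1 : ℕ) : ℝ) (d (f 0) (f n)) ≤ min (r : ℝ) (d (f 0) (f n)) + 1 := by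
        rw [← min_add_add_right]
        apply min_le_min <;> push_cast <;> linarith
      rw [abs_le]
      constructor <;> linarith
    linarith
  -- A discrete connectedness argument: each `w r` is near the part of `f` before `i` or the part
  -- after it, and the type must change somewhere along the geodesic. The two times found there
  -- enclose `i` and have close values, so they are close to each other.
  have hex : ∃ r r', d (w r) (w r') ≤ 3 + 2 * δ ∧ (∃ t ≤ i, d (w r) (f t) ≤ D + 1) ∧
      ∃ t, i ≤ t ∧ t ≤ n ∧ d (w r') (f t) ≤ D + 1 := by
    have hQ : ∀ r, (∃ t ≤ i, d (w r) (f t) ≤ D + 1) ∨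
        ∃ t, i ≤ t ∧ t ≤ n ∧ d (w r) (f t) ≤ D + 1 := by
      intro r
      obtain ⟨t, ht, hdt⟩ := hnear n f hf (w r) (hw1 r)
      rcases le_total t i with hti | hti
      · exact Or.inl ⟨t, hti, by linarith⟩
      · exact Or.inr ⟨t, hti, ht, by linarith⟩
    have h0 : ∃ t ≤ i, d (w 0) (f t) ≤ D + 1 := by
      refine ⟨0, Nat.zero_le _, ?_⟩
      have h1 := hw3 0
      have h2 := min_le_left ((0 : ℕ) : ℝ) (d (f 0) (f n))
      rw [hd.comm]
      push_cast at h2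
      push_cast at h1
      linarith
    by_cases hall : ∀ r, ∃ t ≤ i, d (w r) (f t) ≤ D + 1
    · set r := ⌈d (f 0) (f n)⌉₊
      refine ⟨r, r, by rw [hd.self]; positivity, hall r, n, hi, le_rfl, ?_⟩
      have h1 := hw2 r
      rw [min_eq_right (Nat.le_ceil _)] at h1
      have h2 := hw1 r
      linarith
    · classical
      push Not at hall
      have hspec := Nat.find_spec hall
      have hmin : ∀ {m}, m < Nat.find hall → _ := fun {m} => Nat.find_min hall (m := m)
      generalize Nat.find hall = r at hspec hmin
      rcases r with _ | r
      · obtain ⟨t, ht, h1⟩ := h0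
        exact absurd h1 (not_le.2 (hspec t ht))
      · refine ⟨r, r + 1, hclose r, ?_, ?_⟩
        · have := hmin (Nat.lt_succ_self r)
          push Not at this
          exact this
        · rcases hQ (r + 1) with ⟨t, ht, h1⟩ | h1
          · exact absurd h1 (not_le.2 (hspec t ht))
          · exact h1
  obtain ⟨r, r', hrr, ⟨t, ht, hrt⟩, t', hit', htn', hrt'⟩ := hex
  have hdt : d (f t) (f t') ≤ M := by
    have a1 := hd.triangle (f t) (w r) (f t')
    have a2 := hd.triangle (w r) (w r') (f t')
    have a3 := hd.comm (f t) (w r)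
    linarith
  have h1 := hf.ge t t' (ht.trans hit') htn'
  have h2 := hf.le t i ht hi
  have h3 : R * d (f t) (f t') ≤ R * M := mul_le_mul_of_nonneg_left hdt (by linarith)
  have hti : (i : ℝ) ≤ t' := by exact_mod_cast hit'
  have h4 : R * ((i : ℝ) - t) ≤ R * (R * M + R) :=
    mul_le_mul_of_nonneg_left (by linarith) (by linarith)
  have h5 := gromovProduct_le_dist_between hd (w := f i) (hw1 r)
  have h6 := hd.triangle (f i) (f t) (w r)
  have h7 := hd.comm (f i) (f t)
  have h8 := hd.comm (f t) (w r)
  linarith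

/-- Thin triangles yield the four-point condition. -/
theorem isGromovHyperbolic_of_thin (hd : IsDiscreteGeodesicMetric d) {C : ℝ} (hC : 0 ≤ C)
    (hthin : ∀ (n : ℕ) (f : ℕ → X) (c : X), IsDiscreteGeodesic d n f → ∀ i ≤ n, ∃ r,
      (d (f 0) r + d r c = d (f 0) c ∨ d c r + d r (f n) = d c (f n)) ∧ d (f i) r ≤ C) :
    IsGromovHyperbolic d := by
  have hnear : ∀ (n : ℕ) (f : ℕ → X) (w : X), IsDiscreteGeodesic d n f →
      ∃ i ≤ n, d w (f i) ≤ gromovProduct d w (f 0) (f n) + (2 * C + 2) := by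
    intro n f w hf
    -- Some point of the geodesic is close to both other sides: the last one before closeness to the
    -- first side fails. The extra `1` is the length of a step.
    have hex : ∃ i ≤ n, (∃ r, d (f 0) r + d r w = d (f 0) w ∧ d (f i) r ≤ C + 1) ∧
        ∃ r, d w r + d r (f n) = d w (f n) ∧ d (f i) r ≤ C + 1 := by
      by_cases hall : ∀ i ≤ n, ∃ r, d (f 0) r + d r w = d (f 0) w ∧ d (f i) r ≤ C
      · obtain ⟨r, h1, h2⟩ := hall n le_rfl
        refine ⟨n, le_rfl, ⟨r, h1, by linarith⟩, f n, ?_, ?_⟩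
        · rw [hd.self]; ring
        · rw [hd.self]; linarith
      · classical
        push Not at hall
        obtain ⟨h1, h2⟩ := Nat.find_spec hall
        have hmin : ∀ {m}, m < Nat.find hall → _ := fun {m} => Nat.find_min hall (m := m)
        generalize Nat.find hall = i at h1 h2 hmin
        rcases i with _ | i
        · have := h2 (f 0) (by rw [hd.self]; ring)
          rw [hd.self] at this
          linarith
        · have h3 := hmin (Nat.lt_succ_self i)
          push Not at h3
          obtain ⟨r, hr1, hr2⟩ := h3 (by omega)
          obtain ⟨r', hr', hr2'⟩ := hthin n f w hf (i + 1) h1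
          have hr3 : d w r' + d r' (f n) = d w (f n) := by
            rcases hr' with hr' | hr'
            · exact absurd hr2' (not_le.2 (h2 r' hr'))
            · exact hr'
          refine ⟨i, by omega, ⟨r, hr1, by linarith⟩, r', hr3, ?_⟩
          have h4 := hd.triangle (f i) (f (i + 1)) r'
          have h5 := hf.step_le i (by omega)
          linarith
    obtain ⟨i, hi, ⟨r, hr1, hr2⟩, r', hr1', hr2'⟩ := hex
    refine ⟨i, hi, ?_⟩
    have h1 := hf.add 0 i n (Nat.zero_le _) hi le_rfl
    have h2 := hd.triangle (f 0) r (f i)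
    have h3 := hd.triangle w r (f i)
    have h4 := hd.triangle w r' (f i)
    have h5 := hd.triangle (f i) r' (f n)
    have e1 := hd.comm r (f i)
    have e2 := hd.comm r' (f i)
    have e3 := hd.comm w r
    have e4 := hd.comm w (f 0)
    unfold gromovProduct
    linarith
  have hprod : ∀ w x y z, min (gromovProduct d w x z) (gromovProduct d w z y) - (3 * C + 2) ≤
      gromovProduct d w x y := by
    intro w x y z
    obtain ⟨n, f, rfl, rfl, hf⟩ := hd.exists_geodesic x y
    obtain ⟨i, hi, h1⟩ := hnear n f w hf
    obtain ⟨r, hr, h2⟩ := hthin n f z hf i hi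
    have h3 := hd.triangle w (f i) r
    rcases hr with hr | hr
    · have h4 := gromovProduct_le_dist_between hd (w := w) hr
      have := min_le_left (gromovProduct d w (f 0) z) (gromovProduct d w z (f n))
      linarith
    · have h4 := gromovProduct_le_dist_between hd (w := w) hr
      have := min_le_right (gromovProduct d w (f 0) z) (gromovProduct d w z (f n))
      linarith
  refine ⟨3 * C + 2, by positivity, fun x y z w => ?_⟩
  have h1 := hprod w x y z
  have e1 := hd.comm w x
  have e2 := hd.comm w y
  have e3 := hd.comm w z
  have e4 := hd.comm y z
  unfold gromovProduct at h1
  have a1 := le_max_left (d x z + d y w) (d x w + d y z)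
  have a2 := le_max_right (d x z + d y w) (d x w + d y z)
  rcases min_choice ((d w x + d w z - d x z) / 2) ((d w z + d w y - d z y) / 2) with h2 | h2 <;>
  · rw [h2] at h1
    linarith

/-- Composites of geodesics with a quasi-isometric embedding are quasigeodesics. -/
theorem IsDiscreteGeodesic.isQuasigeodesicSeq {V : Type*} {dV : V → V → ℝ}
    (hV : IsDiscreteGeodesicMetric dV) {R : ℝ} (hR : 1 ≤ R) {f : V → X}
    (hle : ∀ u v, d (f u) (f v) ≤ R * dV u v + R)
    (hge : ∀ u v, dV u v ≤ R * d (f u) (f v) + R) {n : ℕ} {g : ℕ → V}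
    (hg : IsDiscreteGeodesic dV n g) :
    IsQuasigeodesicSeq d (2 * R) n (fun i => f (g i)) where
  le i j hij hj := by
    have h1 := hg.dist_le hV i j hij hj
    have h2 := hle (g i) (g j)
    have h3 : R * dV (g i) (g j) ≤ R * ((j : ℝ) - i) :=
      mul_le_mul_of_nonneg_left h1 (by linarith)
    have h4 : (i : ℝ) ≤ j := by exact_mod_cast hij
    have h5 : 0 ≤ R * ((j : ℝ) - i) := mul_nonneg (by linarith) (by linarith)
    linarith
  ge i j hij hj := by
    have h1 := hg.le_dist hV i j hij hj
    have h2 := hge (g i) (g j)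
    linarith

/-- A geodesic space that embeds quasi-isometrically into a hyperbolic space is hyperbolic. -/
theorem IsGromovHyperbolic.of_quasiIsometricEmbedding {V : Type*} {dV : V → V → ℝ}
    (hV : IsDiscreteGeodesicMetric dV) (hd : IsDiscreteGeodesicMetric d)
    (h : IsGromovHyperbolic d) {R : ℝ} (hR : 1 ≤ R) {f : V → X}
    (hle : ∀ u v, d (f u) (f v) ≤ R * dV u v + R)
    (hge : ∀ u v, dV u v ≤ R * d (f u) (f v) + R) : IsGromovHyperbolic dV := by
  obtain ⟨δ, hδ, h⟩ := h
  change FourPoint d δ at h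
  have hR2 : 1 ≤ 2 * R := by linarith
  obtain ⟨D, hD, hnear⟩ := h.exists_geodesic_near_quasigeodesic hd hδ hR2
  obtain ⟨C, hC, hprod⟩ := h.exists_gromovProduct_quasigeodesic_le hd hδ hR2
  -- A small Gromov product in `X` pulls back to closeness in `V`: the image of `p` is near a
  -- geodesic between the images of `a` and `c`, and that geodesic is near the image of a geodesic
  -- of `V`.
  have hback : ∀ (p a c : V), gromovProduct d (f p) (f a) (f c) ≤ C + δ →
      ∃ r, dV a r + dV r c = dV a c ∧ dV p r ≤ R * (C + 3 * δ + 1 + D) + R := by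
    intro p a c hp
    obtain ⟨w, hw1, hw2⟩ := h.exists_between_near hd (f p) (f a) (f c)
    obtain ⟨n, g, rfl, rfl, hg⟩ := hV.exists_geodesic a c
    obtain ⟨i, hi, hwi⟩ := hnear n _ (hg.isQuasigeodesicSeq hV hR hle hge) w hw1
    refine ⟨g i, hg.add 0 i n (Nat.zero_le _) hi le_rfl, (hge _ _).trans ?_⟩
    have h1 := hd.triangle (f p) w (f (g i))
    have h2 : R * d (f p) (f (g i)) ≤ R * (C + 3 * δ + 1 + D) :=
      mul_le_mul_of_nonneg_left (by linarith) (by linarith)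
    linarith
  refine isGromovHyperbolic_of_thin hV (C := R * (C + 3 * δ + 1 + D) + R) (by positivity) ?_
  intro n g c hg i hi
  have h1 := hprod n _ (hg.isQuasigeodesicSeq hV hR hle hge) i hi
  have h2 := h.min_gromovProduct_le hd (f (g i)) (f (g 0)) (f (g n)) (f c)
  rcases min_choice (gromovProduct d (f (g i)) (f (g 0)) (f c))
    (gromovProduct d (f (g i)) (f c) (f (g n))) with h3 | h3
  · obtain ⟨r, hr1, hr2⟩ := hback (g i) (g 0) c (by linarith)
    exact ⟨r, Or.inl hr1, hr2⟩
  · obtain ⟨r, hr1, hr2⟩ := hback (g i) c (g n) (by linarith)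
    exact ⟨r, Or.inr hr1, hr2⟩

end Morse

/-! ### Discrete geodesics from shortest paths -/

section PathMetrics

variable {X : Type*} {d : X → X → ℝ}

theorem dist_le_sum_of_triangle (hself : ∀ x, d x x = 0)
    (htri : ∀ x y z, d x z ≤ d x y + d y z) (f : ℕ → X) {i j : ℕ} (hij : i ≤ j) :
    d (f i) (f j) ≤ ∑ k ∈ Finset.Ico i j, d (f k) (f (k + 1)) := by
  induction j, hij using Nat.le_induction with
  | base => simp [hself]
  | succ j hij ih =>
    rw [Finset.sum_Ico_succ_top hij]
    linarith [htri (f i) (f j) (f (j + 1))]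

/-- If the steps add up to no more than the distance of the ends, no triangle inequality along the
sequence can be strict. -/
theorem dist_add_of_sum_le (hself : ∀ x, d x x = 0)
    (htri : ∀ x y z, d x z ≤ d x y + d y z) {n : ℕ} {f : ℕ → X}
    (hsum : ∑ k ∈ Finset.Ico 0 n, d (f k) (f (k + 1)) ≤ d (f 0) (f n)) (i j k : ℕ)
    (hij : i ≤ j) (hjk : j ≤ k) (hkn : k ≤ n) :
    d (f i) (f j) + d (f j) (f k) = d (f i) (f k) := by
  have h1 := dist_le_sum_of_triangle hself htri f (Nat.zero_le i)
  have h2 := dist_le_sum_of_triangle hself htri f hij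
  have h3 := dist_le_sum_of_triangle hself htri f hjk
  have h4 := dist_le_sum_of_triangle hself htri f hkn
  have h5 := Finset.sum_Ico_consecutive (fun k => d (f k) (f (k + 1))) (Nat.zero_le i) hij
  have h6 := Finset.sum_Ico_consecutive (fun k => d (f k) (f (k + 1))) (Nat.zero_le j) hjk
  have h7 := Finset.sum_Ico_consecutive (fun k => d (f k) (f (k + 1))) (Nat.zero_le k) hkn
  have h8 := htri (f 0) (f i) (f n)
  have h9 := htri (f i) (f k) (f n)
  have h10 := htri (f i) (f j) (f k)
  linarith

theorem isDiscreteGeodesicMetric_dist {V : Type*} {Γ : SimpleGraph V} (hΓ : Γ.Connected) :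
    IsDiscreteGeodesicMetric (fun u v => (Γ.dist u v : ℝ)) where
  self x := by simp
  comm x y := by rw [SimpleGraph.dist_comm]
  triangle x y z := by exact_mod_cast hΓ.dist_triangle
  exists_geodesic x y := by
    obtain ⟨w, hw⟩ := hΓ.exists_walk_length_eq_dist x y
    have hstep : ∀ i < w.length, (Γ.dist (w.getVert i) (w.getVert (i + 1)) : ℝ) = 1 := by
      intro i hi
      exact_mod_cast SimpleGraph.dist_eq_one_iff_adj.2 (w.adj_getVert_succ hi)
    refine ⟨w.length, w.getVert, w.getVert_zero, w.getVert_length, ?_, ?_, ?_⟩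
    · apply dist_add_of_sum_le (d := fun u v => (Γ.dist u v : ℝ)) (by simp)
        (fun x y z => by exact_mod_cast hΓ.dist_triangle)
      rw [w.getVert_zero, w.getVert_length, ← hw, Finset.sum_congr rfl
        (fun i hi => hstep i (Finset.mem_Ico.1 hi).2)]
      simp
    · intro i hi
      rw [hstep i hi]; norm_num
    · intro i hi
      rw [hstep i hi]

end PathMetrics

/-! ### Word metrics and Lipschitz maps -/

section Words

variable {G : Type*} [Group G] {S : Set G}

theorem mulCayley_connected (hS : Subgroup.closure S = ⊤) :
    (SimpleGraph.mulCayley S).Connected := by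
  have key : ∀ g x : G, (SimpleGraph.mulCayley S).Reachable x (x * g) := by
    intro g
    have hg : g ∈ Subgroup.closure S := hS ▸ Subgroup.mem_top g
    induction hg using Subgroup.closure_induction with
    | mem s hs =>
      intro x
      by_cases h : x = x * s
      · rw [← h]
      · exact SimpleGraph.Adj.reachable
          ((SimpleGraph.mulCayley_adj' _ _ _).2 ⟨h, s, hs, Or.inl rfl⟩)
    | one => intro x; simp
    | mul a b _ _ ha hb =>
      intro x
      rw [← mul_assoc]
      exact (ha x).trans (hb _)
    | inv a _ ha =>
      intro x
      have := (ha (x * a⁻¹)).symm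
      simpa using this
  exact
    { preconnected := fun x y => by simpa using key (x⁻¹ * y) x
      nonempty := ⟨1⟩ }

theorem isDiscreteGeodesicMetric_wordDist (hS : Subgroup.closure S = ⊤) :
    IsDiscreteGeodesicMetric (wordDist S) :=
  isDiscreteGeodesicMetric_dist (mulCayley_connected hS)

/-- A map to a pseudometric space which is bounded on edges is Lipschitz. -/
theorem le_mul_wordDist {Y : Type*} {d : Y → Y → ℝ} (hself : ∀ y, d y y = 0)
    (htri : ∀ x y z, d x z ≤ d x y + d y z) (hS : Subgroup.closure S = ⊤) {C : ℝ} (f : G → Y)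
    (hf : ∀ g h, (SimpleGraph.mulCayley S).Adj g h → d (f g) (f h) ≤ C) (g h : G) :
    d (f g) (f h) ≤ C * wordDist S g h := by
  obtain ⟨w, hw⟩ := (mulCayley_connected hS).exists_walk_length_eq_dist g h
  unfold wordDist
  rw [← hw]
  clear hw
  induction w with
  | nil => simp [hself]
  | cons hadj p ih =>
    rename_i u v w
    have h1 := htri (f u) (f v) (f w)
    have h2 := hf _ _ hadj
    rw [SimpleGraph.Walk.length_cons]
    push_cast
    linarith

theorem wordDist_mul_left (hS : Subgroup.closure S = ⊤) (a g h : G) :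
    wordDist S (a * g) (a * h) = wordDist S g h := by
  have hd := isDiscreteGeodesicMetric_wordDist hS
  have key : ∀ a g h : G, wordDist S (a * g) (a * h) ≤ wordDist S g h := by
    intro a g h
    have := le_mul_wordDist hd.self hd.triangle hS (C := 1) (fun x => a * x) (fun g h hgh => by
      have : (SimpleGraph.mulCayley S).Adj (a * g) (a * h) := by simpa using hgh
      unfold wordDist
      exact_mod_cast (SimpleGraph.dist_eq_one_iff_adj.2 this).le) g h
    linarith
  refine le_antisymm (key a g h) ?_
  simpa using key a⁻¹ (a * g) (a * h)

/-- Each ball lies in the union of the preceding ball and its products with `S` and `S⁻¹`. This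
turns bounds on exit points into finiteness. -/
theorem finite_wordDist_le (hS : IsFiniteGeneratingSet S) (D : ℝ) :
    {g : G | wordDist S 1 g ≤ D}.Finite := by
  have hd := isDiscreteGeodesicMetric_wordDist hS.2
  have key : ∀ n : ℕ, {g : G | (SimpleGraph.mulCayley S).dist 1 g ≤ n}.Finite := by
    intro n
    induction n with
    | zero =>
      refine (Set.finite_singleton (1 : G)).subset fun g hg => ?_
      have h1 : (SimpleGraph.mulCayley S).dist 1 g = 0 := Nat.le_zero.1 hg
      exact ((mulCayley_connected hS.2).dist_eq_zero_iff.1 h1).symm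
    | succ n ih =>
      refine (ih.union ((ih.mul hS.1).union (ih.mul hS.1.inv))).subset fun g hg => ?_
      obtain ⟨w, hw⟩ := (mulCayley_connected hS.2).exists_walk_length_eq_dist 1 g
      rcases Nat.lt_or_ge n w.length with hlt | hle
      · have hlen : w.length = n + 1 := by
          have : (SimpleGraph.mulCayley S).dist 1 g ≤ n + 1 := hg
          omega
        have hadj := w.adj_getVert_succ (i := n) (by omega)
        have hend : w.getVert (n + 1) = g := by rw [← hlen, w.getVert_length]
        rw [hend] at hadj
        have hn : (SimpleGraph.mulCayley S).dist 1 (w.getVert n) ≤ n :=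
          (SimpleGraph.dist_le (w.take n)).trans (by simp)
        obtain ⟨-, s, hs, h1 | h1⟩ := (SimpleGraph.mulCayley_adj' _ _ _).1 hadj
        · exact Or.inr (Or.inl ⟨_, hn, s, hs, h1⟩)
        · exact Or.inr (Or.inr ⟨_, hn, s⁻¹, by simpa using hs, by simp [h1]⟩)
      · exact Or.inl (by rw [Set.mem_ofPred_eq, ← hw]; exact hle)
  refine (key ⌊D⌋₊).subset fun g hg => ?_
  exact Nat.le_floor hg

/-- A map between finitely generated groups is Lipschitz if multiplication by each generator
changes its values by elements of a finite set. -/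
theorem exists_wordDist_le {A B : Type*} [Group A] [Group B] {SA : Set A} {SB : Set B}
    (hA : IsFiniteGeneratingSet SA) (hB : Subgroup.closure SB = ⊤) (f : A → B)
    (hf : ∀ a ∈ SA, {b | ∃ x, b = (f x)⁻¹ * f (x * a)}.Finite) :
    ∃ C : ℝ, 1 ≤ C ∧ ∀ x y, wordDist SB (f x) (f y) ≤ C * wordDist SA x y := by
  have hd := isDiscreteGeodesicMetric_wordDist hB
  have hfin : (⋃ a ∈ SA, {b | ∃ x, b = (f x)⁻¹ * f (x * a)}).Finite := hA.1.biUnion hf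
  obtain ⟨C, hC⟩ := (hfin.image (fun b => wordDist SB 1 b)).bddAbove
  have hbound : ∀ a ∈ SA, ∀ x, wordDist SB (f x) (f (x * a)) ≤ max C 1 := by
    intro a ha x
    have h1 : wordDist SB 1 ((f x)⁻¹ * f (x * a)) ≤ C := by
      apply hC
      exact ⟨_, Set.mem_biUnion ha ⟨x, rfl⟩, rfl⟩
    have h2 := wordDist_mul_left hB (f x) 1 ((f x)⁻¹ * f (x * a))
    rw [mul_one, mul_inv_cancel_left] at h2
    rw [h2]
    exact h1.trans (le_max_left _ _)
  refine ⟨max C 1, le_max_right _ _, le_mul_wordDist hd.self hd.triangle hA.2 f ?_⟩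
  intro g h hgh
  obtain ⟨-, s, hs, rfl | rfl⟩ := (SimpleGraph.mulCayley_adj' _ _ _).1 hgh
  · exact hbound s hs g
  · rw [hd.comm]
    exact hbound s hs h

end Words

/-! ### The path metric of the coned-off graph -/

section ConedOffMetric

variable {G : Type*} [Group G] {S : Set G} {H : Subgroup G}

open SimpleGraph

theorem edgeLength_le_one (u v : G ⊕ G ⧸ H) : edgeLength u v ≤ 1 := by
  rcases u with u | u <;> rcases v with v | v <;> simp only [edgeLength] <;> norm_num

theorem half_le_edgeLength (u v : G ⊕ G ⧸ H) : 1 / 2 ≤ edgeLength u v := by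
  rcases u with u | u <;> rcases v with v | v <;> simp only [edgeLength] <;> norm_num

theorem edgeLength_comm (u v : G ⊕ G ⧸ H) : edgeLength u v = edgeLength v u := by
  rcases u with u | u <;> rcases v with v | v <;> rfl

/-- The length of a path in the coned-off graph. -/
def pathLength {u v : G ⊕ G ⧸ H} (w : (conedOffGraph S H).Walk u v) : ℝ :=
  segmentLength w 0 w.length

theorem pathLength_nil (u : G ⊕ G ⧸ H) :
    pathLength (Walk.nil : (conedOffGraph S H).Walk u u) = 0 := by
  simp [pathLength, segmentLength]

theorem pathLength_cons {u v w : G ⊕ G ⧸ H} (h : (conedOffGraph S H).Adj u v)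
    (p : (conedOffGraph S H).Walk v w) :
    pathLength (Walk.cons h p) = edgeLength u v + pathLength p := by
  unfold pathLength segmentLength
  rw [Nat.Ico_zero_eq_range, Nat.Ico_zero_eq_range, Walk.length_cons, Finset.sum_range_succ']
  simp only [Walk.getVert_cons_succ, Walk.getVert_zero]
  rw [add_comm]

theorem pathLength_append {u v w : G ⊕ G ⧸ H} (p : (conedOffGraph S H).Walk u v)
    (q : (conedOffGraph S H).Walk v w) :
    pathLength (p.append q) = pathLength p + pathLength q := by
  induction p with
  | nil => simp [pathLength_nil]
  | cons h p ih => rw [Walk.cons_append, pathLength_cons, pathLength_cons, ih, add_assoc]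

theorem pathLength_reverse {u v : G ⊕ G ⧸ H} (p : (conedOffGraph S H).Walk u v) :
    pathLength p.reverse = pathLength p := by
  induction p with
  | nil => simp
  | cons h p ih =>
    rw [Walk.reverse_cons, pathLength_append, pathLength_cons, pathLength_cons, pathLength_nil,
      ih, edgeLength_comm]
    ring

theorem pathLength_le_length {u v : G ⊕ G ⧸ H} (p : (conedOffGraph S H).Walk u v) :
    pathLength p ≤ p.length := by
  induction p with
  | nil => simp [pathLength_nil]
  | cons h p ih =>
    rename_i u v w
    rw [pathLength_cons, Walk.length_cons]
    push_cast
    linarith [edgeLength_le_one u v]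

theorem length_le_two_mul_pathLength {u v : G ⊕ G ⧸ H} (p : (conedOffGraph S H).Walk u v) :
    (p.length : ℝ) ≤ 2 * pathLength p := by
  induction p with
  | nil => simp [pathLength_nil]
  | cons h p ih =>
    rename_i u v w
    rw [pathLength_cons, Walk.length_cons]
    push_cast
    linarith [half_le_edgeLength u v]

/-- Lengths are half-integers, so the infimum defining `conedOffDist` is attained. -/
theorem exists_pathLength_eq {u v : G ⊕ G ⧸ H} (p : (conedOffGraph S H).Walk u v) :
    ∃ n : ℕ, 2 * pathLength p = n := by
  induction p with
  | nil => exact ⟨0, by simp [pathLength_nil]⟩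
  | cons h p ih =>
    obtain ⟨n, hn⟩ := ih
    rename_i u v w
    rw [pathLength_cons, mul_add, hn]
    rcases u with u | u <;> rcases v with v | v <;> simp only [edgeLength]
    · exact ⟨2 + n, by push_cast; ring⟩
    · exact ⟨1 + n, by push_cast; ring⟩
    · exact ⟨1 + n, by push_cast; ring⟩
    · exact ⟨1 + n, by push_cast; ring⟩

theorem pathLength_nonneg {u v : G ⊕ G ⧸ H} (p : (conedOffGraph S H).Walk u v) :
    0 ≤ pathLength p := by
  have := length_le_two_mul_pathLength p
  have h : (0 : ℝ) ≤ p.length := Nat.cast_nonneg _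
  linarith

/-- A nonempty family of paths has a shortest member. -/
theorem exists_minimal_pathLength {u v : G ⊕ G ⧸ H}
    (P : (conedOffGraph S H).Walk u v → Prop) (hP : ∃ w, P w) :
    ∃ w, P w ∧ ∀ w', P w' → pathLength w ≤ pathLength w' := by
  classical
  have hex : ∃ n : ℕ, ∃ w, P w ∧ 2 * pathLength w = n := by
    obtain ⟨w, hw⟩ := hP
    obtain ⟨n, hn⟩ := exists_pathLength_eq w
    exact ⟨n, w, hw, hn⟩
  obtain ⟨w, hw, hn⟩ := Nat.find_spec hex
  refine ⟨w, hw, fun w' hw' => ?_⟩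
  obtain ⟨m, hm⟩ := exists_pathLength_eq w'
  have h1 : Nat.find hex ≤ m := Nat.find_min' hex ⟨w', hw', hm⟩
  have h2 : (Nat.find hex : ℝ) ≤ m := by exact_mod_cast h1
  linarith

theorem segmentLength_eq_pathLength {u v : G ⊕ G ⧸ H} (w : (conedOffGraph S H).Walk u v)
    {i j : ℕ} (hj : j ≤ w.length) :
    segmentLength w i j = pathLength ((w.drop i).take (j - i)) := by
  unfold pathLength segmentLength
  have hlen : ((w.drop i).take (j - i)).length = j - i := by simp; omega
  rw [hlen, Finset.sum_Ico_eq_sum_range, Nat.Ico_zero_eq_range]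
  refine Finset.sum_congr rfl fun k hk => ?_
  have hk' := Finset.mem_range.1 hk
  rw [Walk.take_getVert, Walk.take_getVert, Walk.drop_getVert, Walk.drop_getVert,
    min_eq_right (by omega), min_eq_right (by omega), add_assoc]

theorem conedOffDist_le_pathLength {u v : G ⊕ G ⧸ H} (w : (conedOffGraph S H).Walk u v) :
    conedOffDist S H u v ≤ pathLength w :=
  ciInf_le ⟨0, by rintro _ ⟨w, rfl⟩; exact pathLength_nonneg w⟩ w

theorem conedOffGraph_connected (hS : Subgroup.closure S = ⊤) :
    (conedOffGraph S H).Connected := by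
  have h1 : ∀ g h : G, (conedOffGraph S H).Reachable (Sum.inl g) (Sum.inl h) := by
    intro g h
    obtain ⟨w⟩ := (mulCayley_connected hS).preconnected g h
    induction w with
    | nil => exact Reachable.refl _
    | cons hadj p ih =>
      refine Reachable.trans (Adj.reachable ?_) ih
      exact hadj
  have h2 : ∀ u : G ⊕ G ⧸ H, (conedOffGraph S H).Reachable (Sum.inl 1) u := by
    rintro (g | c)
    · exact h1 1 g
    · obtain ⟨g, rfl⟩ := QuotientGroup.mk_surjective c
      refine (h1 1 g).trans (Adj.reachable ?_)
      exact rfl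
  exact
    { preconnected := fun u v => (h2 u).symm.trans (h2 v)
      nonempty := ⟨Sum.inl 1⟩ }

theorem exists_pathLength_eq_conedOffDist (hS : Subgroup.closure S = ⊤) (u v : G ⊕ G ⧸ H) :
    ∃ w : (conedOffGraph S H).Walk u v, pathLength w = conedOffDist S H u v := by
  obtain ⟨w₀⟩ := (conedOffGraph_connected (H := H) hS).preconnected u v
  obtain ⟨w, -, hw⟩ := exists_minimal_pathLength (fun _ => True) ⟨w₀, trivial⟩
  refine ⟨w, le_antisymm ?_ (conedOffDist_le_pathLength w)⟩
  have : Nonempty ((conedOffGraph S H).Walk u v) := ⟨w₀⟩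
  exact le_ciInf fun w' => hw w' trivial

theorem conedOffDist_self (u : G ⊕ G ⧸ H) : conedOffDist S H u u = 0 := by
  refine le_antisymm ?_ (Real.iInf_nonneg fun w => pathLength_nonneg w)
  exact (conedOffDist_le_pathLength Walk.nil).trans_eq (pathLength_nil u)

theorem conedOffDist_triangle (hS : Subgroup.closure S = ⊤) (u v w : G ⊕ G ⧸ H) :
    conedOffDist S H u w ≤ conedOffDist S H u v + conedOffDist S H v w := by
  obtain ⟨p, hp⟩ := exists_pathLength_eq_conedOffDist hS u v
  obtain ⟨q, hq⟩ := exists_pathLength_eq_conedOffDist hS v w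
  rw [← hp, ← hq, ← pathLength_append]
  exact conedOffDist_le_pathLength _

theorem conedOffDist_comm (hS : Subgroup.closure S = ⊤) (u v : G ⊕ G ⧸ H) :
    conedOffDist S H u v = conedOffDist S H v u := by
  have key : ∀ u v : G ⊕ G ⧸ H, conedOffDist S H u v ≤ conedOffDist S H v u := by
    intro u v
    obtain ⟨p, hp⟩ := exists_pathLength_eq_conedOffDist hS v u
    rw [← hp, ← pathLength_reverse]
    exact conedOffDist_le_pathLength _
  exact le_antisymm (key u v) (key v u)

theorem conedOffDist_le_edgeLength {u v : G ⊕ G ⧸ H} (h : (conedOffGraph S H).Adj u v) :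
    conedOffDist S H u v ≤ edgeLength u v := by
  have := conedOffDist_le_pathLength (Walk.cons h Walk.nil)
  rwa [pathLength_cons, pathLength_nil, add_zero] at this

theorem half_le_conedOffDist (hS : Subgroup.closure S = ⊤) {u v : G ⊕ G ⧸ H} (h : u ≠ v) :
    1 / 2 ≤ conedOffDist S H u v := by
  obtain ⟨p, hp⟩ := exists_pathLength_eq_conedOffDist hS u v
  have h1 := length_le_two_mul_pathLength p
  have h2 : 1 ≤ p.length := by
    rw [Nat.one_le_iff_ne_zero]
    exact fun h0 => h (Walk.eq_of_length_eq_zero h0)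
  have h3 : (1 : ℝ) ≤ p.length := by exact_mod_cast h2
  linarith

/-- Vertices of the coned-off graph are joined by geodesic paths. -/
theorem exists_geodesic_walk (hS : Subgroup.closure S = ⊤) (u v : G ⊕ G ⧸ H) :
    ∃ w : (conedOffGraph S H).Walk u v, (w.length : ℝ) ≤ 2 * conedOffDist S H u v ∧
      IsDiscreteGeodesic (conedOffDist S H) w.length w.getVert := by
  obtain ⟨w, hw⟩ := exists_pathLength_eq_conedOffDist hS u v
  refine ⟨w, hw ▸ length_le_two_mul_pathLength w, ?_, ?_, ?_⟩
  · apply dist_add_of_sum_le conedOffDist_self (conedOffDist_triangle hS)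
    rw [w.getVert_zero, w.getVert_length, ← hw]
    refine Finset.sum_le_sum fun i hi => ?_
    exact conedOffDist_le_edgeLength (w.adj_getVert_succ (Finset.mem_Ico.1 hi).2)
  · intro i hi
    exact half_le_conedOffDist hS (w.adj_getVert_succ hi).ne
  · intro i hi
    exact (conedOffDist_le_edgeLength (w.adj_getVert_succ hi)).trans (edgeLength_le_one _ _)

theorem isDiscreteGeodesicMetric_conedOffDist (hS : Subgroup.closure S = ⊤) :
    IsDiscreteGeodesicMetric (conedOffDist S H) where
  self := conedOffDist_self
  comm := conedOffDist_comm hS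
  triangle := conedOffDist_triangle hS
  exists_geodesic u v := by
    obtain ⟨w, -, hw⟩ := exists_geodesic_walk (H := H) hS u v
    exact ⟨w.length, w.getVert, w.getVert_zero, w.getVert_length, hw⟩

/-- A map to a pseudometric space which is Lipschitz on edges is Lipschitz. -/
theorem le_mul_conedOffDist {Y : Type*} {d : Y → Y → ℝ} (hself : ∀ y, d y y = 0)
    (htri : ∀ x y z, d x z ≤ d x y + d y z) (hS : Subgroup.closure S = ⊤) {C : ℝ}
    (f : G ⊕ G ⧸ H → Y)
    (hf : ∀ u v, (conedOffGraph S H).Adj u v → d (f u) (f v) ≤ C * edgeLength u v)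
    (u v : G ⊕ G ⧸ H) : d (f u) (f v) ≤ C * conedOffDist S H u v := by
  obtain ⟨w, hw⟩ := exists_pathLength_eq_conedOffDist hS u v
  rw [← hw]
  clear hw
  induction w with
  | nil => simp [hself, pathLength_nil]
  | cons hadj p ih =>
    rename_i u v w
    have h1 := htri (f u) (f v) (f w)
    have h2 := hf _ _ hadj
    rw [pathLength_cons]
    linarith

theorem conedOffDist_inl_le_wordDist (hS : Subgroup.closure S = ⊤) (g h : G) :
    conedOffDist S H (Sum.inl g) (Sum.inl h) ≤ wordDist S g h := by
  have := le_mul_wordDist conedOffDist_self (conedOffDist_triangle (H := H) hS) hS (C := 1)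
    Sum.inl (fun g h hgh => by
      have hadj : (conedOffGraph S H).Adj (Sum.inl g) (Sum.inl h) := hgh
      exact conedOffDist_le_edgeLength hadj) g h
  linarith

/-- The map of vertices of coned-off graphs induced by a map that preserves cosets. -/
def vertexMap {G' : Type*} [Group G'] (H : Subgroup G) (H' : Subgroup G') (f : G → G') :
    G ⊕ G ⧸ H → G' ⊕ G' ⧸ H'
  | .inl g => .inl (f g)
  | .inr c => .inr (f c.out : G' ⧸ H')

/-- The representative chosen in `vertexMap` is immaterial once `f` respects cosets. -/
theorem vertexMap_inr {G' : Type*} [Group G'] {H' : Subgroup G'} {f : G → G'}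
    (hf : ∀ x y : G, (x : G ⧸ H) = y → (f x : G' ⧸ H') = f y) (x : G) :
    vertexMap H H' f (Sum.inr (x : G ⧸ H)) = Sum.inr (f x : G' ⧸ H') := by
  exact congrArg Sum.inr (hf _ x (QuotientGroup.out_eq' _))

theorem conedOffDist_vertexMap_mul_left_le (hS : Subgroup.closure S = ⊤) (a : G)
    (u v : G ⊕ G ⧸ H) : conedOffDist S H (vertexMap H H (a * ·) u) (vertexMap H H (a * ·) v) ≤
      conedOffDist S H u v := by
  have hcoset : ∀ x y : G, (x : G ⧸ H) = y → ((a * x : G) : G ⧸ H) = (a * y : G) := by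
    intro x y hxy
    rw [QuotientGroup.eq] at hxy ⊢
    simpa [mul_assoc] using hxy
  have := le_mul_conedOffDist conedOffDist_self (conedOffDist_triangle (H := H) hS) hS (C := 1)
    (vertexMap H H (a * ·)) (fun u v huv => by
      rw [one_mul]
      rcases u with g | c <;> rcases v with h | c'
      · have hadj : (conedOffGraph S H).Adj (Sum.inl (a * g)) (Sum.inl (a * h)) :=
          (SimpleGraph.mulCayley_adj_mul_iff_right).2 huv
        exact conedOffDist_le_edgeLength hadj
      · obtain rfl : (g : G ⧸ H) = c' := huv
        rw [vertexMap_inr hcoset]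
        have hadj : (conedOffGraph S H).Adj (Sum.inl (a * g)) (Sum.inr ((a * g : G) : G ⧸ H)) :=
          rfl
        exact conedOffDist_le_edgeLength hadj
      · obtain rfl : (h : G ⧸ H) = c := huv
        rw [vertexMap_inr hcoset]
        have hadj : (conedOffGraph S H).Adj (Sum.inr ((a * h : G) : G ⧸ H)) (Sum.inl (a * h)) :=
          rfl
        exact conedOffDist_le_edgeLength hadj
      · exact absurd huv id) u v
  linarith

theorem conedOffDist_mul_left_inl_inr (hS : Subgroup.closure S = ⊤) (a g x : G) :
    conedOffDist S H (Sum.inl (a * g)) (Sum.inr ((a * x : G) : G ⧸ H)) =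
      conedOffDist S H (Sum.inl g) (Sum.inr (x : G ⧸ H)) := by
  have hcoset : ∀ a x y : G, (x : G ⧸ H) = y → ((a * x : G) : G ⧸ H) = (a * y : G) := by
    intro a x y hxy
    rw [QuotientGroup.eq] at hxy ⊢
    simpa [mul_assoc] using hxy
  have key : ∀ a g x : G, conedOffDist S H (Sum.inl (a * g)) (Sum.inr ((a * x : G) : G ⧸ H)) ≤
      conedOffDist S H (Sum.inl g) (Sum.inr (x : G ⧸ H)) := by
    intro a g x
    have := conedOffDist_vertexMap_mul_left_le (H := H) hS a (Sum.inl g) (Sum.inr (x : G ⧸ H))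
    rw [vertexMap_inr (hcoset a)] at this
    exact this
  refine le_antisymm (key a g x) ?_
  simpa using key a⁻¹ (a * g) (a * x)

theorem conedOffDist_mul_left_inr_inr (hS : Subgroup.closure S = ⊤) (a g x : G) :
    conedOffDist S H (Sum.inr ((a * g : G) : G ⧸ H)) (Sum.inr ((a * x : G) : G ⧸ H)) =
      conedOffDist S H (Sum.inr (g : G ⧸ H)) (Sum.inr (x : G ⧸ H)) := by
  have hcoset : ∀ a x y : G, (x : G ⧸ H) = y → ((a * x : G) : G ⧸ H) = (a * y : G) := by
    intro a x y hxy
    rw [QuotientGroup.eq] at hxy ⊢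
    simpa [mul_assoc] using hxy
  have key : ∀ a g x : G,
      conedOffDist S H (Sum.inr ((a * g : G) : G ⧸ H)) (Sum.inr ((a * x : G) : G ⧸ H)) ≤
      conedOffDist S H (Sum.inr (g : G ⧸ H)) (Sum.inr (x : G ⧸ H)) := by
    intro a g x
    have := conedOffDist_vertexMap_mul_left_le (H := H) hS a (Sum.inr (g : G ⧸ H))
      (Sum.inr (x : G ⧸ H))
    rw [vertexMap_inr (hcoset a), vertexMap_inr (hcoset a)] at this
    exact this
  refine le_antisymm (key a g x) ?_
  simpa using key a⁻¹ (a * g) (a * x)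

end ConedOffMetric

/-! ### Consequences of bounded coset penetration -/

section Penetration

variable {G : Type*} [Group G] {S : Set G} {H : Subgroup G}

open SimpleGraph

theorem pathLength_copy {u v u' v' : G ⊕ G ⧸ H} (p : (conedOffGraph S H).Walk u v)
    (hu : u = u') (hv : v = v') : pathLength (p.copy hu hv) = pathLength p := by
  subst hu hv
  rfl

theorem half_mul_le_segmentLength {u v : G ⊕ G ⧸ H} (w : (conedOffGraph S H).Walk u v)
    {i j : ℕ} (hij : i ≤ j) : ((j : ℝ) - i) / 2 ≤ segmentLength w i j := by
  unfold segmentLength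
  have h := Finset.card_nsmul_le_sum (Finset.Ico i j)
    (fun k => edgeLength (w.getVert k) (w.getVert (k + 1))) (1 / 2)
    (fun k _ => half_le_edgeLength _ _)
  rw [Nat.card_Ico, nsmul_eq_mul, Nat.cast_sub hij] at h
  linarith

theorem segmentLength_le {u v : G ⊕ G ⧸ H} (w : (conedOffGraph S H).Walk u v)
    {i j : ℕ} (hij : i ≤ j) : segmentLength w i j ≤ (j : ℝ) - i := by
  unfold segmentLength
  have h := Finset.sum_le_card_nsmul (Finset.Ico i j)
    (fun k => edgeLength (w.getVert k) (w.getVert (k + 1))) 1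
    (fun k _ => edgeLength_le_one _ _)
  rw [Nat.card_Ico, nsmul_eq_mul, Nat.cast_sub hij] at h
  linarith

/-- Injective paths are quasigeodesics, with a constant that depends only on their length. -/
theorem isElectricQuasigeodesic_of_injective (hS : Subgroup.closure S = ⊤) {u v : G ⊕ G ⧸ H}
    (w : (conedOffGraph S H).Walk u v) {P : ℝ} (hP : 2 * (w.length : ℝ) ≤ P)
    (hw : ∀ i j, i < j → j ≤ w.length → w.getVert i ≠ w.getVert j) :
    IsElectricQuasigeodesic P w := by
  intro i j hij hj
  rcases hij.eq_or_lt with rfl | hlt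
  · rw [conedOffDist_self]
    simp [segmentLength]
  · have h1 := half_le_conedOffDist hS (hw i j hlt hj)
    have h2 := segmentLength_le w hij
    have h3 : (j : ℝ) ≤ w.length := by exact_mod_cast hj
    have h4 : (0 : ℝ) ≤ i := Nat.cast_nonneg i
    nlinarith

/-- Segments of a shortest path in a set `Y` of vertices are shortest paths in `Y`. -/
theorem segmentLength_le_of_minimal {Y : Set (G ⊕ G ⧸ H)} {u v : G ⊕ G ⧸ H}
    {w : (conedOffGraph S H).Walk u v} (hw : ∀ i, w.getVert i ∈ Y)
    (hmin : ∀ w' : (conedOffGraph S H).Walk u v, (∀ i, w'.getVert i ∈ Y) →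
      pathLength w ≤ pathLength w') {i j : ℕ} (hij : i ≤ j) (hj : j ≤ w.length)
    {a b : G ⊕ G ⧸ H} (r : (conedOffGraph S H).Walk a b) (ha : w.getVert i = a)
    (hb : w.getVert j = b) (hr : ∀ t, r.getVert t ∈ Y) :
    segmentLength w i j ≤ pathLength r := by
  have hb' : b = (w.drop i).getVert (j - i) := by
    rw [Walk.drop_getVert, ← hb]
    congr 1
    omega
  have h1 := hmin ((w.take i).append ((r.copy ha.symm hb').append ((w.drop i).drop (j - i)))) (by
    intro t
    rw [Walk.getVert_append, Walk.getVert_append]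
    split_ifs
    · rw [Walk.take_getVert]; exact hw _
    · rw [Walk.getVert_copy]; exact hr _
    · rw [Walk.drop_getVert, Walk.drop_getVert]; exact hw _)
  have h2 : pathLength w = pathLength (w.take i) + (segmentLength w i j +
      pathLength ((w.drop i).drop (j - i))) := by
    rw [segmentLength_eq_pathLength w hj, ← pathLength_append, Walk.append_take_drop_eq,
      ← pathLength_append, Walk.append_take_drop_eq]
  rw [pathLength_append, pathLength_append, pathLength_copy] at h1
  linarith

theorem getVert_ne_of_minimal {Y : Set (G ⊕ G ⧸ H)} {u v : G ⊕ G ⧸ H}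
    {w : (conedOffGraph S H).Walk u v} (hw : ∀ i, w.getVert i ∈ Y)
    (hmin : ∀ w' : (conedOffGraph S H).Walk u v, (∀ i, w'.getVert i ∈ Y) →
      pathLength w ≤ pathLength w') (i j : ℕ) (hij : i < j) (hj : j ≤ w.length) :
    w.getVert i ≠ w.getVert j := by
  intro heq
  have h1 := segmentLength_le_of_minimal hw hmin hij.le hj Walk.nil rfl heq.symm
    (fun t => by simpa using hw i)
  rw [pathLength_nil] at h1
  have h2 := half_mul_le_segmentLength w hij.le
  have h3 : (i : ℝ) + 1 ≤ j := by exact_mod_cast hij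
  linarith

/-- Shortest paths in a set of vertices which contains the cone points of the cosets that it
meets more than once are without backtracking. -/
theorem isWithoutBacktracking_of_minimal {Y : Set (G ⊕ G ⧸ H)}
    (hY : ∀ c : G ⧸ H, Sum.inr c ∉ Y → ∀ a ∈ Y, ∀ b ∈ Y, InConedCoset c a → InConedCoset c b →
      a = b) {u v : G ⊕ G ⧸ H}
    {w : (conedOffGraph S H).Walk u v} (hw : ∀ i, w.getVert i ∈ Y)
    (hmin : ∀ w' : (conedOffGraph S H).Walk u v, (∀ i, w'.getVert i ∈ Y) →
      pathLength w ≤ pathLength w') : IsWithoutBacktracking w := by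
  intro c i j k hij hjk hk hi hk'
  rcases hij.eq_or_lt with rfl | hij
  · exact hi
  rcases hjk.eq_or_lt with rfl | hjk
  · exact hk'
  have hne := getVert_ne_of_minimal hw hmin i k (hij.trans hjk) hk
  -- The shortcut through this cone point has length at most `1`, against at least `(k - i) / 2 ≥ 1`
  -- for the path. It is strictly shorter if exactly one end is the cone point; otherwise equality
  -- forces two half-edges, and the middle vertex is the cone point itself.
  have hc : Sum.inr c ∈ Y := by
    by_contra hc
    exact hne (hY c hc _ (hw i) _ (hw k) hi hk')
  have hle := half_mul_le_segmentLength w (hij.trans hjk).le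
  have h2 : (i : ℝ) + 2 ≤ k := by
    have : i + 2 ≤ k := by omega
    exact_mod_cast this
  have hcomp := fun {a b} (r : (conedOffGraph S H).Walk a b) =>
    segmentLength_le_of_minimal hw hmin (hij.trans hjk).le hk r
  rcases hgi : w.getVert i with g | c₁
  · rcases hgk : w.getVert k with h | c₂
    · rw [hgi] at hi
      rw [hgk] at hk'
      have e1 : (conedOffGraph S H).Adj (Sum.inl g) (Sum.inr c) := hi
      have e2 : (conedOffGraph S H).Adj (Sum.inr c) (Sum.inl h) := hk'
      have h3 := hcomp (Walk.cons e1 (Walk.cons e2 Walk.nil)) hgi hgk (by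
        intro t
        rcases t with _ | _ | t
        · rw [Walk.getVert_zero, ← hgi]; exact hw i
        · exact hc
        · simp only [Walk.getVert_cons_succ, Walk.getVert_nil]
          rw [← hgk]; exact hw k)
      rw [pathLength_cons, pathLength_cons, pathLength_nil] at h3
      simp only [edgeLength] at h3
      have h4 : k = i + 2 := by
        have : (k : ℝ) ≤ i + 2 := by linarith
        have : k ≤ i + 2 := by exact_mod_cast this
        omega
      obtain rfl : j = i + 1 := by omega
      subst h4
      unfold segmentLength at h3
      rw [Finset.sum_Ico_succ_top (by omega), Finset.sum_Ico_succ_top (by omega)] at h3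
      simp only [Finset.Ico_self, Finset.sum_empty] at h3
      have h5 := half_le_edgeLength (w.getVert (i + 1)) (w.getVert (i + 1 + 1))
      have hadj := w.adj_getVert_succ (i := i) (by omega)
      rcases hm : w.getVert (i + 1) with m | c'
      · rw [hm] at h5
        rw [hgi, hm] at h3
        simp only [edgeLength] at h3 h5
        linarith
      · rw [hgi, hm] at hadj
        have h6 : (g : G ⧸ H) = c' := hadj
        exact h6.symm.trans hi
    · rw [hgi] at hi
      rw [hgk] at hk'
      obtain rfl : c₂ = c := hk'
      have e1 : (conedOffGraph S H).Adj (Sum.inl g) (Sum.inr c₂) := hi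
      have h3 := hcomp (Walk.cons e1 Walk.nil) hgi hgk (by
        intro t
        rcases t with _ | t
        · rw [Walk.getVert_zero, ← hgi]; exact hw i
        · exact hc)
      rw [pathLength_cons, pathLength_nil] at h3
      simp only [edgeLength] at h3
      linarith
  · rcases hgk : w.getVert k with h | c₂
    · rw [hgi] at hi
      rw [hgk] at hk'
      obtain rfl : c₁ = c := hi
      have e1 : (conedOffGraph S H).Adj (Sum.inr c₁) (Sum.inl h) := hk'
      have h3 := hcomp (Walk.cons e1 Walk.nil) hgi hgk (by
        intro t
        rcases t with _ | t
        · exact hc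
        · simp only [Walk.getVert_cons_succ, Walk.getVert_nil]
          rw [← hgk]; exact hw k)
      rw [pathLength_cons, pathLength_nil] at h3
      simp only [edgeLength] at h3
      linarith
    · rw [hgi] at hi
      rw [hgk] at hk'
      obtain rfl : c₁ = c := hi
      obtain rfl : c₂ = c₁ := hk'
      exact absurd (hgi.trans hgk.symm) hne

/-- A path of bounded length that leaves `H` at `x` and comes back in one step from its end point
to `y` has `x` close to `y`. -/
theorem BoundedCosetPenetration.exists_wordDist_le_of_excursion (hS : Subgroup.closure S = ⊤)
    (hB : BoundedCosetPenetration S H) (n : ℕ) : ∃ D : ℝ, ∀ x y z : G,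
      (x : G ⧸ H) = ((1 : G) : G ⧸ H) → (y : G ⧸ H) = ((1 : G) : G ⧸ H) →
      (z : G ⧸ H) ≠ ((1 : G) : G ⧸ H) → (mulCayley S).Adj y z →
      ∀ w : (conedOffGraph S H).Walk (Sum.inl x) (Sum.inl z), w.length ≤ n →
      (∀ i, w.getVert i = Sum.inl x ∨ ¬ InConedCoset ((1 : G) : G ⧸ H) (w.getVert i)) →
      wordDist S x y ≤ D := by
  -- Twice the number of edges of either path used below: `3` for `α`, and at most `2 * n` for `β`.
  obtain ⟨D, hD⟩ := hB (4 * n + 6) (by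
    have : (0 : ℝ) ≤ n := Nat.cast_nonneg n
    linarith)
  refine ⟨max D 0, fun x y z hx hy hz hyz w hwn hw => ?_⟩
  by_cases hxy : x = y
  · rw [hxy, (isDiscreteGeodesicMetric_wordDist hS).self]
    exact le_max_right _ _
  -- `Y` meets the coned coset of `H` only in `x` and contains every other cone point. A shortest
  -- path in `Y` is therefore without backtracking and does not penetrate `H`.
  set Y : Set (G ⊕ G ⧸ H) := {a | a = Sum.inl x ∨ ¬ InConedCoset ((1 : G) : G ⧸ H) a} with hYdef
  obtain ⟨β, hβ, hmin⟩ := exists_minimal_pathLength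
    (fun w : (conedOffGraph S H).Walk (Sum.inl x) (Sum.inl z) => ∀ i, w.getVert i ∈ Y) ⟨w, hw⟩
  have hβlen : (β.length : ℝ) ≤ 2 * n := by
    have h1 := length_le_two_mul_pathLength β
    have h2 := hmin w hw
    have h3 := pathLength_le_length w
    have h4 : (w.length : ℝ) ≤ n := by exact_mod_cast hwn
    linarith
  have e1 : (conedOffGraph S H).Adj (Sum.inl x) (Sum.inr ((1 : G) : G ⧸ H)) := hx
  have e2 : (conedOffGraph S H).Adj (Sum.inr ((1 : G) : G ⧸ H)) (Sum.inl y) := hy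
  have e3 : (conedOffGraph S H).Adj (Sum.inl y) (Sum.inl z) := hyz
  have hxz : x ≠ z := fun h => hz (h ▸ hx)
  have hzy : y ≠ z := fun h => hz (h ▸ hy)
  -- The competitor crosses the cone point and exits `H` at `y`. Both paths end at `z` because a
  -- path that left `H` and ended at `y` would backtrack.
  set α := Walk.cons e1 (Walk.cons e2 (Walk.cons e3 Walk.nil)) with hα
  have α0 : α.getVert 0 = Sum.inl x := rfl
  have α1 : α.getVert 1 = Sum.inr ((1 : G) : G ⧸ H) := rfl
  have α2 : α.getVert 2 = Sum.inl y := rfl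
  have α3 : α.getVert 3 = Sum.inl z := rfl
  have αlen : α.length = 3 := rfl
  have hn : (0 : ℝ) ≤ n := Nat.cast_nonneg n
  have qα : IsElectricQuasigeodesic (4 * n + 6) α := by
    apply isElectricQuasigeodesic_of_injective hS
    · rw [αlen]; push_cast; linarith
    · intro i j hij hj
      rw [αlen] at hj
      interval_cases j <;> interval_cases i <;> simp [α0, α1, α2, α3, hxy, hxz, hzy]
  have bα : IsWithoutBacktracking α := by
    intro c i j k hij hjk hk hi hk'
    rw [αlen] at hk
    by_cases hc : c = ((1 : G) : G ⧸ H)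
    · subst hc
      have hk2 : k ≤ 2 := by
        by_contra hcon
        obtain rfl : k = 3 := by omega
        rw [α3] at hk'
        exact hz hk'
      have hj2 : j ≤ 2 := hjk.trans hk2
      interval_cases j
      · exact hx
      · exact rfl
      · exact hy
    · have hi3 : 3 ≤ i := by
        by_contra hcon
        have hi2 : i ≤ 2 := by omega
        interval_cases i
        · exact hc (hi.symm.trans hx)
        · exact hc hi.symm
        · exact hc (hi.symm.trans hy)
      obtain rfl : j = i := by omega
      exact hi
  have qβ : IsElectricQuasigeodesic (4 * n + 6) β := by
    apply isElectricQuasigeodesic_of_injective hS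
    · linarith
    · exact getVert_ne_of_minimal hβ hmin
  have bβ : IsWithoutBacktracking β := by
    refine isWithoutBacktracking_of_minimal ?_ hβ hmin
    intro c hc a ha b hb hac hbc
    have hc1 : ((1 : G) : G ⧸ H) = c := by
      by_contra hne
      exact hc (Or.inr fun h => hne (Eq.symm h))
    subst hc1
    rcases ha with rfl | ha
    · rcases hb with rfl | hb
      · rfl
      · exact absurd hbc hb
    · exact absurd hac ha
  have pβ : ¬ Penetrates β ((1 : G) : G ⧸ H) := by
    intro hp
    obtain ⟨i, hi, -⟩ := Walk.mem_support_iff_exists_getVert.1 hp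
    have h1 := hβ i
    rw [hi] at h1
    rcases h1 with h1 | h1
    · cases h1
    · exact h1 rfl
  have pα : Penetrates α ((1 : G) : G ⧸ H) :=
    Walk.mem_support_iff_exists_getVert.2 ⟨1, α1, by rw [αlen]; norm_num⟩
  refine le_trans ?_ (le_max_left D 0)
  refine (hD x z α β qα bα qβ bβ ((1 : G) : G ⧸ H)).1 pα pβ x y ?_ ?_
  · exact ⟨hx, 0, Nat.zero_le _, α0, fun j hj => absurd hj (Nat.not_lt_zero j)⟩
  · refine ⟨hy, 2, by rw [αlen]; norm_num, α2, fun j hj hj3 => ?_⟩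
    rw [αlen] at hj3
    obtain rfl : j = 3 := by omega
    exact hz

/-- Bounded coset penetration: elements of `H` joined by a short path that avoids the cone point
of `H` are close. -/
theorem BoundedCosetPenetration.exists_wordDist_le_of_avoiding (hS : Subgroup.closure S = ⊤)
    (hB : BoundedCosetPenetration S H) (n : ℕ) : ∃ D : ℝ, ∀ x y : G,
      (x : G ⧸ H) = ((1 : G) : G ⧸ H) → (y : G ⧸ H) = ((1 : G) : G ⧸ H) →
      ∀ w : (conedOffGraph S H).Walk (Sum.inl x) (Sum.inl y), w.length ≤ n →
      (∀ i, w.getVert i ≠ Sum.inr ((1 : G) : G ⧸ H)) → wordDist S x y ≤ D := by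
  have hd := isDiscreteGeodesicMetric_wordDist hS
  induction n with
  | zero =>
    refine ⟨0, fun x y _ _ w hw _ => ?_⟩
    have h1 : Sum.inl x = Sum.inl y := Walk.eq_of_length_eq_zero (Nat.le_zero.1 hw)
    rw [Sum.inl_injective h1, hd.self]
  | succ n ih =>
    classical
    obtain ⟨D₁, hD₁⟩ := ih
    obtain ⟨D₂, hD₂⟩ := hB.exists_wordDist_le_of_excursion hS n
    refine ⟨|D₁| + (|D₂| + 1), fun x y hx hy w hwn hw => ?_⟩
    have a1 := abs_nonneg D₁
    have a2 := abs_nonneg D₂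
    rcases Nat.eq_zero_or_pos w.length with h0 | hpos
    · have h1 : Sum.inl x = Sum.inl y := Walk.eq_of_length_eq_zero h0
      rw [Sum.inl_injective h1, hd.self]
      positivity
    -- The last visit to `H` before the final vertex, which itself lies in `H`. The earlier part is
    -- covered by induction; the rest is a single edge or an excursion.
    set i := Nat.findGreatest (fun i => InConedCoset ((1 : G) : G ⧸ H) (w.getVert i))
      (w.length - 1) with hi
    have hile : i ≤ w.length - 1 := Nat.findGreatest_le _
    have hicos : InConedCoset ((1 : G) : G ⧸ H) (w.getVert i) :=
      Nat.findGreatest_spec (P := fun i => InConedCoset ((1 : G) : G ⧸ H) (w.getVert i))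
        (Nat.zero_le _) (by rw [w.getVert_zero]; exact hx)
    have himax : ∀ j, i < j → j ≤ w.length - 1 →
        ¬ InConedCoset ((1 : G) : G ⧸ H) (w.getVert j) :=
      fun j h1 h2 => Nat.findGreatest_is_greatest h1 h2
    clear_value i
    rcases hxi : w.getVert i with x' | c
    swap
    · rw [hxi] at hicos
      obtain rfl : c = ((1 : G) : G ⧸ H) := hicos
      exact absurd hxi (hw i)
    rw [hxi] at hicos
    have hx' : (x' : G ⧸ H) = ((1 : G) : G ⧸ H) := hicos
    have h1 : wordDist S x x' ≤ D₁ := by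
      refine hD₁ x x' hx hx' ((w.take i).copy rfl hxi) ?_ ?_
      · rw [Walk.length_copy, Walk.take_length]
        omega
      · intro t
        rw [Walk.getVert_copy, Walk.take_getVert]
        exact hw _
    have h2 : wordDist S x' y ≤ |D₂| + 1 := by
      have hadj := w.adj_getVert_succ (i := w.length - 1) (by omega)
      have hend : w.getVert (w.length - 1 + 1) = Sum.inl y := by
        rw [Nat.sub_add_cancel hpos, w.getVert_length]
      rw [hend] at hadj
      rcases hile.eq_or_lt with rfl | hlt
      · rw [hxi] at hadj
        have h3 : (mulCayley S).Adj x' y := hadj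
        unfold wordDist
        rw [SimpleGraph.dist_eq_one_iff_adj.2 h3]
        push_cast
        linarith
      · have hlast := himax (w.length - 1) hlt le_rfl
        rcases hz : w.getVert (w.length - 1) with z | c
        swap
        · rw [hz] at hadj
          have h3 : (y : G ⧸ H) = c := hadj
          exact absurd (by rw [hz, ← h3, hy]) (hw (w.length - 1))
        rw [hz] at hadj hlast
        have hz' : (w.drop i).getVert (w.length - 1 - i) = Sum.inl z := by
          rw [Walk.drop_getVert, ← hz]
          congr 1
          omega
        have h3 := hD₂ x' y z hx' hy hlast (SimpleGraph.Adj.symm hadj)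
          (((w.drop i).take (w.length - 1 - i)).copy hxi hz') (by
            rw [Walk.length_copy, Walk.take_length]
            omega) (by
            intro t
            rw [Walk.getVert_copy, Walk.take_getVert, Walk.drop_getVert]
            rcases Nat.eq_zero_or_pos (min (w.length - 1 - i) t) with h0 | hp
            · left
              rw [h0, add_zero, hxi]
            · right
              exact himax _ (by omega) (by omega))
        have := le_abs_self D₂
        linarith
    have := hd.triangle x x' y
    have := le_abs_self D₁
    linarith

end Penetration

/-! ### Exit points of geodesics and automorphisms preserving the subgroup -/

section Exits

variable {G : Type*} [Group G] {S : Set G} {H : Subgroup G}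

open SimpleGraph

/-- `u` and `v` are joined by a path of length at most `n` which avoids the cone point of `H`. -/
def JoinedAvoiding (S : Set G) (H : Subgroup G) (n : ℕ) (u v : G ⊕ G ⧸ H) : Prop :=
  ∃ w : (conedOffGraph S H).Walk u v, w.length ≤ n ∧
    ∀ i, w.getVert i ≠ Sum.inr ((1 : G) : G ⧸ H)

theorem JoinedAvoiding.refl {u : G ⊕ G ⧸ H} (hu : u ≠ Sum.inr ((1 : G) : G ⧸ H)) :
    JoinedAvoiding S H 0 u u :=
  ⟨Walk.nil, le_rfl, fun i => by simpa using hu⟩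

theorem JoinedAvoiding.mono {m n : ℕ} (hmn : m ≤ n) {u v : G ⊕ G ⧸ H}
    (h : JoinedAvoiding S H m u v) : JoinedAvoiding S H n u v := by
  obtain ⟨w, hw, h⟩ := h
  exact ⟨w, hw.trans hmn, h⟩

theorem JoinedAvoiding.trans {m n : ℕ} {u v w : G ⊕ G ⧸ H}
    (h₁ : JoinedAvoiding S H m u v) (h₂ : JoinedAvoiding S H n v w) :
    JoinedAvoiding S H (m + n) u w := by
  obtain ⟨p, hp, h₁⟩ := h₁
  obtain ⟨q, hq, h₂⟩ := h₂
  refine ⟨p.append q, by rw [Walk.length_append]; omega, fun i => ?_⟩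
  rw [Walk.getVert_append]
  split_ifs
  · exact h₁ _
  · exact h₂ _

theorem JoinedAvoiding.of_adj {u v : G ⊕ G ⧸ H} (h : (conedOffGraph S H).Adj u v)
    (hu : u ≠ Sum.inr ((1 : G) : G ⧸ H)) (hv : v ≠ Sum.inr ((1 : G) : G ⧸ H)) :
    JoinedAvoiding S H 1 u v := by
  refine ⟨Walk.cons h Walk.nil, le_rfl, fun i => ?_⟩
  rcases i with _ | i
  · exact hu
  · simpa using hv

theorem joinedAvoiding_inl (hS : Subgroup.closure S = ⊤) (g h : G) :
    JoinedAvoiding S H ((mulCayley S).dist g h) (Sum.inl g) (Sum.inl h) := by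
  obtain ⟨w, hw⟩ := (mulCayley_connected hS).exists_walk_length_eq_dist g h
  rw [← hw]
  clear hw
  induction w with
  | nil => exact JoinedAvoiding.refl (by simp)
  | cons hadj p ih =>
    rename_i u v w
    have e : (conedOffGraph S H).Adj (Sum.inl u) (Sum.inl v) := hadj
    rw [Walk.length_cons, add_comm]
    exact (JoinedAvoiding.of_adj e (by simp) (by simp)).trans ih

theorem joinedAvoiding_of_between (hS : Subgroup.closure S = ⊤) {u v : G ⊕ G ⧸ H}
    (h : ∀ z, conedOffDist S H u z + conedOffDist S H z v = conedOffDist S H u v →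
      z ≠ Sum.inr ((1 : G) : G ⧸ H)) :
    JoinedAvoiding S H ⌊2 * conedOffDist S H u v⌋₊ u v := by
  obtain ⟨w, hw, hgeo⟩ := exists_geodesic_walk hS u v
  refine ⟨w, Nat.le_floor hw, fun i => h _ ?_⟩
  rcases le_total i w.length with hi | hi
  · have := hgeo.add 0 i w.length (Nat.zero_le _) hi le_rfl
    rwa [w.getVert_zero, w.getVert_length] at this
  · rw [w.getVert_of_length_le hi, conedOffDist_self, add_zero]

theorem mk_map_eq_of_mk_eq {φ : G ≃* G} (hφ : ∀ g, φ g ∈ H ↔ g ∈ H) (x y : G)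
    (hxy : (x : G ⧸ H) = y) : (φ x : G ⧸ H) = φ y := by
  rw [QuotientGroup.eq] at hxy ⊢
  rwa [← map_inv, ← map_mul, hφ]

theorem exists_wordDist_map_le {A B : Type*} [Group A] [Group B] {SA : Set A} {SB : Set B}
    (hA : IsFiniteGeneratingSet SA) (hB : Subgroup.closure SB = ⊤) (f : A →* B) :
    ∃ C : ℝ, 1 ≤ C ∧ ∀ x y, wordDist SB (f x) (f y) ≤ C * wordDist SA x y := by
  refine exists_wordDist_le hA hB f fun a _ => (Set.finite_singleton (f a)).subset ?_
  rintro b ⟨x, rfl⟩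
  simp

/-- Automorphisms that preserve `H` are Lipschitz on the coned-off graph. -/
theorem exists_conedOffDist_vertexMap_le (hS : IsFiniteGeneratingSet S) {φ : G ≃* G}
    (hφ : ∀ g, φ g ∈ H ↔ g ∈ H) : ∃ C : ℝ, 1 ≤ C ∧
      (∀ x y, wordDist S (φ x) (φ y) ≤ C * wordDist S x y) ∧
      ∀ u v, conedOffDist S H (vertexMap H H φ u) (vertexMap H H φ v) ≤
        C * conedOffDist S H u v := by
  obtain ⟨C, hC, hlip⟩ := exists_wordDist_map_le hS hS.2 φ.toMonoidHom
  refine ⟨C, hC, hlip, le_mul_conedOffDist conedOffDist_self (conedOffDist_triangle hS.2) hS.2 _ ?_⟩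
  have hcoset := mk_map_eq_of_mk_eq hφ
  intro u v huv
  rcases u with g | c <;> rcases v with h | c'
  · refine (conedOffDist_inl_le_wordDist hS.2 _ _).trans ((hlip g h).trans ?_)
    have e : (mulCayley S).Adj g h := huv
    unfold wordDist
    rw [SimpleGraph.dist_eq_one_iff_adj.2 e]
    simp [edgeLength]
  · obtain rfl : (g : G ⧸ H) = c' := huv
    rw [vertexMap_inr hcoset]
    have e : (conedOffGraph S H).Adj (Sum.inl (φ g)) (Sum.inr (φ g : G ⧸ H)) := rfl
    refine (conedOffDist_le_edgeLength e).trans ?_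
    simp only [edgeLength]
    linarith
  · obtain rfl : (h : G ⧸ H) = c := huv
    rw [vertexMap_inr hcoset]
    have e : (conedOffGraph S H).Adj (Sum.inr (φ h : G ⧸ H)) (Sum.inl (φ h)) := rfl
    refine (conedOffDist_le_edgeLength e).trans ?_
    simp only [edgeLength]
    linarith
  · exact absurd huv id

theorem vertexMap_symm_vertexMap {φ : G ≃* G} (hφ : ∀ g, φ g ∈ H ↔ g ∈ H) (u : G ⊕ G ⧸ H) :
    vertexMap H H φ.symm (vertexMap H H φ u) = u := by
  have hφ' : ∀ g, φ.symm g ∈ H ↔ g ∈ H := fun g => by rw [← hφ, φ.apply_symm_apply]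
  rcases u with g | c
  · simp [vertexMap]
  · obtain ⟨g, rfl⟩ := QuotientGroup.mk_surjective c
    rw [vertexMap_inr (mk_map_eq_of_mk_eq hφ), vertexMap_inr (mk_map_eq_of_mk_eq hφ'),
      φ.symm_apply_apply]

/-- A Cayley edge is replaced by a path inside the Cayley graph, which meets no cone point. A cone
edge maps to a cone edge, and only the cone point of `H` is sent to the cone point of `H`. -/
theorem joinedAvoiding_vertexMap_of_adj (hS : Subgroup.closure S = ⊤) {φ : G ≃* G}
    (hφ : ∀ g, φ g ∈ H ↔ g ∈ H) {C : ℝ} (hC : 1 ≤ C)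
    (hlip : ∀ x y, wordDist S (φ x) (φ y) ≤ C * wordDist S x y) {u v : G ⊕ G ⧸ H}
    (huv : (conedOffGraph S H).Adj u v) (hu : u ≠ Sum.inr ((1 : G) : G ⧸ H))
    (hv : v ≠ Sum.inr ((1 : G) : G ⧸ H)) :
    JoinedAvoiding S H ⌊C⌋₊ (vertexMap H H φ u) (vertexMap H H φ v) := by
  have hcoset := mk_map_eq_of_mk_eq hφ
  have h1 : 1 ≤ ⌊C⌋₊ := Nat.le_floor (by simpa using hC)
  have hne : ∀ g : G, (Sum.inr (g : G ⧸ H) : G ⊕ G ⧸ H) ≠ Sum.inr ((1 : G) : G ⧸ H) →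
      (Sum.inr (φ g : G ⧸ H) : G ⊕ G ⧸ H) ≠ Sum.inr ((1 : G) : G ⧸ H) := by
    intro g hg hcon
    apply hg
    have h2 := Sum.inr_injective hcon
    rw [eq_comm, QuotientGroup.eq] at h2
    rw [inv_one, one_mul, hφ] at h2
    congr 1
    rw [eq_comm, QuotientGroup.eq]
    simpa using h2
  rcases u with g | c <;> rcases v with h | c'
  · refine (joinedAvoiding_inl hS (φ g) (φ h)).mono (Nat.le_floor ?_)
    have e : (mulCayley S).Adj g h := huv
    have h2 := hlip g h
    unfold wordDist at h2
    rw [SimpleGraph.dist_eq_one_iff_adj.2 e] at h2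
    simpa using h2
  · obtain rfl : (g : G ⧸ H) = c' := huv
    rw [vertexMap_inr hcoset]
    have e : (conedOffGraph S H).Adj (Sum.inl (φ g)) (Sum.inr (φ g : G ⧸ H)) := rfl
    exact (JoinedAvoiding.of_adj e (by simp) (hne g hv)).mono h1
  · obtain rfl : (h : G ⧸ H) = c := huv
    rw [vertexMap_inr hcoset]
    have e : (conedOffGraph S H).Adj (Sum.inr (φ h : G ⧸ H)) (Sum.inl (φ h)) := rfl
    exact (JoinedAvoiding.of_adj e (hne h hu) (by simp)).mono h1
  · exact absurd huv id

theorem JoinedAvoiding.of_steps {m : ℕ} {f : ℕ → G ⊕ G ⧸ H} (n : ℕ)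
    (h0 : f 0 ≠ Sum.inr ((1 : G) : G ⧸ H))
    (h : ∀ i < n, JoinedAvoiding S H m (f i) (f (i + 1))) :
    JoinedAvoiding S H (n * m) (f 0) (f n) := by
  induction n with
  | zero => exact (JoinedAvoiding.refl h0).mono (Nat.zero_le _)
  | succ n ih =>
    rw [Nat.succ_mul]
    exact (ih fun i hi => h i (by omega)).trans (h n (Nat.lt_succ_self n))

/-- An automorphism that preserves `H` changes the points where geodesics from the cone point
of `H` to other cone points leave `H` by a bounded amount. -/
theorem exists_wordDist_le_of_exit (hS : IsFiniteGeneratingSet S)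
    (hhyp : IsGromovHyperbolic (conedOffDist S H)) (hB : BoundedCosetPenetration S H)
    {φ : G ≃* G} (hφ : ∀ g, φ g ∈ H ↔ g ∈ H) : ∃ D : ℝ, ∀ k h : G, h ∈ H →
      conedOffDist S H (Sum.inr ((1 : G) : G ⧸ H)) (Sum.inr (k : G ⧸ H)) =
        1 / 2 + conedOffDist S H (Sum.inl 1) (Sum.inr (k : G ⧸ H)) →
      conedOffDist S H (Sum.inr ((1 : G) : G ⧸ H)) (Sum.inr (φ k : G ⧸ H)) =
        1 / 2 + conedOffDist S H (Sum.inl h) (Sum.inr (φ k : G ⧸ H)) →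
      wordDist S 1 h ≤ D := by
  have hφ' : ∀ g, φ.symm g ∈ H ↔ g ∈ H := fun g => by rw [← hφ, φ.apply_symm_apply]
  have hd := isDiscreteGeodesicMetric_conedOffDist (H := H) hS.2
  obtain ⟨C₁, hC₁, hlip, hle₁⟩ := exists_conedOffDist_vertexMap_le hS hφ
  obtain ⟨C₂, hC₂, -, hle₂⟩ := exists_conedOffDist_vertexMap_le hS hφ'
  set C := max C₁ C₂ with hCdef
  have hC : 1 ≤ C := hC₁.trans (le_max_left _ _)
  set d := conedOffDist S H with hddef
  set Φ := vertexMap H H φ with hΦ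
  have hle : ∀ u v, d (Φ u) (Φ v) ≤ C * d u v + C := fun u v => by
    have h1 := hle₁ u v
    have h2 := mul_le_mul_of_nonneg_right (le_max_left C₁ C₂) (hd.nonneg u v)
    linarith
  have hge : ∀ u v, d u v ≤ C * d (Φ u) (Φ v) + C := fun u v => by
    have h1 := hle₂ (Φ u) (Φ v)
    rw [hΦ, vertexMap_symm_vertexMap hφ, vertexMap_symm_vertexMap hφ] at h1
    have h2 := mul_le_mul_of_nonneg_right (le_max_right C₁ C₂) (hd.nonneg (Φ u) (Φ v))
    linarith
  obtain ⟨δ, hδ, hfour⟩ := hhyp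
  change FourPoint d δ at hfour
  obtain ⟨A, hA, hprod⟩ := hfour.exists_gromovProduct_quasigeodesic_le hd hδ
    (show 1 ≤ 2 * C by linarith)
  -- `A` bounds the Gromov product for the image quasigeodesic, `1` pays for moving its initial
  -- point from `1` to `h`, and `2 * δ + 1` is the cost of finding a nearby geodesic point.
  set M := A + 1 + 2 * δ + 1 with hM
  -- After `T` steps the quasigeodesic is farther than `M + 1` from its start, so a crossing of
  -- length at most `M` cannot reach the cone point of `H`.
  set T := ⌈2 * C * (M + 2)⌉₊ + 1 with hT
  set m := ⌊C₁⌋₊ with hm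
  -- The three summands bound the legs from `1` to `p` along the image, from `p` across to `r`, and
  -- from `r` back to `h`.
  obtain ⟨D, hD⟩ := hB.exists_wordDist_le_of_avoiding hS.2
    (T * m + ⌊2 * M⌋₊ + ⌊2 * (1 + (2 * C * T + 2 * C) + M)⌋₊)
  refine ⟨D, fun k h hh hk hφk => ?_⟩
  have hcone : ∀ g ∈ H, d (Sum.inl g) (Sum.inr ((1 : G) : G ⧸ H)) ≤ 1 / 2 := by
    intro g hg
    have e : (conedOffGraph S H).Adj (Sum.inl g) (Sum.inr ((1 : G) : G ⧸ H)) := by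
      change (g : G ⧸ H) = ((1 : G) : G ⧸ H)
      rw [eq_comm, QuotientGroup.eq]
      simpa using hg
    exact conedOffDist_le_edgeLength e
  obtain ⟨γ, -, hγ⟩ := exists_geodesic_walk hS.2 (Sum.inl 1) (Sum.inr (k : G ⧸ H))
  have hq := hγ.isQuasigeodesicSeq hd hC hle hge
  set n := γ.length with hn
  have hγ0 : γ.getVert 0 = Sum.inl 1 := γ.getVert_zero
  have hγn : γ.getVert n = Sum.inr (k : G ⧸ H) := γ.getVert_length
  have hΦ0 : Φ (γ.getVert 0) = Sum.inl 1 := by rw [hγ0]; simp [hΦ, vertexMap]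
  have hΦn : Φ (γ.getVert n) = Sum.inr (φ k : G ⧸ H) := by
    rw [hγn]; exact vertexMap_inr (mk_map_eq_of_mk_eq hφ) k
  -- By `hk` the target is farther from the cone point of `H` than from `1`, so a geodesic from `1`
  -- cannot pass through that cone point.
  have havoid : ∀ i ≤ n, γ.getVert i ≠ Sum.inr ((1 : G) : G ⧸ H) := by
    intro i hi hcon
    have h1 := hγ.add 0 i n (Nat.zero_le _) hi le_rfl
    rw [hγ0, hγn, hcon] at h1
    have h2 := hd.nonneg (Sum.inl 1) (Sum.inr ((1 : G) : G ⧸ H))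
    linarith
  -- If the geodesic has fewer than `T` steps, its end serves as `p` and no crossing is needed.
  set t := min n T with ht
  have htn : t ≤ n := min_le_left _ _
  have htT : t ≤ T := min_le_right _ _
  set p := Φ (γ.getVert t) with hp
  set v := (Sum.inr (φ k : G ⧸ H) : G ⊕ G ⧸ H) with hv
  have hjoin₁ : JoinedAvoiding S H (T * m) (Sum.inl 1) p := by
    have h1 := JoinedAvoiding.of_steps (S := S) (m := m) (f := fun i => Φ (γ.getVert i)) t
      (by rw [hΦ0]; simp)
      (fun i hi => joinedAvoiding_vertexMap_of_adj hS.2 hφ hC₁ hlip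
        (γ.adj_getVert_succ (by omega)) (havoid i (by omega)) (havoid (i + 1) (by omega)))
    rw [hΦ0] at h1
    exact h1.mono (Nat.mul_le_mul_right m htT)
  have hp1 : d (Sum.inl 1) p ≤ 2 * C * T + 2 * C := by
    have h1 := hq.le 0 t (Nat.zero_le _) htn
    rw [hΦ0] at h1
    have h2 : (t : ℝ) ≤ T := by exact_mod_cast htT
    have h3 : 2 * C * ((t : ℝ) - (0 : ℕ)) ≤ 2 * C * T :=
      mul_le_mul_of_nonneg_left (by push_cast; linarith) (by linarith)
    linarith
  have h1h : d (Sum.inl 1) (Sum.inl h) ≤ 1 := by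
    have h1 := hd.triangle (Sum.inl 1) (Sum.inr ((1 : G) : G ⧸ H)) (Sum.inl h)
    have h2 := hcone 1 H.one_mem
    have h3 := hcone h hh
    rw [hd.comm] at h3
    linarith
  have hr : ∃ r, d (Sum.inl h) r + d r v = d (Sum.inl h) v ∧ d p r ≤ M ∧
      JoinedAvoiding S H ⌊2 * M⌋₊ p r := by
    rcases le_total n T with hnT | hnT
    · have htn' : t = n := min_eq_left hnT
      have hpv : p = v := by rw [hp, htn', hΦn]
      refine ⟨v, by rw [hd.self, add_zero], ?_, ?_⟩
      · rw [hpv, hd.self]; positivity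
      · rw [hpv]
        refine (JoinedAvoiding.refl ?_).mono (Nat.zero_le _)
        intro hcon
        have h1 := hd.nonneg (Sum.inl h) v
        rw [← hcon, hd.self] at hφk
        linarith
    · have htT' : t = T := min_eq_right hnT
      have h1 := hprod n _ hq t htn
      rw [hΦ0, hΦn] at h1
      have h2 : gromovProduct d p (Sum.inl h) v ≤ A + 1 := by
        have a1 := hd.triangle p (Sum.inl 1) (Sum.inl h)
        have a2 := hd.triangle (Sum.inl 1) (Sum.inl h) v
        unfold gromovProduct at h1 ⊢
        linarith
      obtain ⟨r, hr1, hr2⟩ := hfour.exists_between_near hd p (Sum.inl h) v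
      have hprM : d p r ≤ M := by linarith
      refine ⟨r, hr1, hprM, (joinedAvoiding_of_between hS.2 ?_).mono
        (Nat.floor_le_floor (by linarith))⟩
      intro z hz hcon
      have h3 := hq.ge 0 t (Nat.zero_le _) htn
      rw [hΦ0, htT', hT] at h3
      have h4 := Nat.le_ceil (2 * C * (M + 2))
      push_cast at h3
      have h5 : M + 1 < d (Sum.inl 1) p := by
        rw [hp, htT']
        by_contra! hcon'
        have h6 : 2 * C * d (Sum.inl 1) (Φ (γ.getVert T)) ≤ 2 * C * (M + 1) :=
          mul_le_mul_of_nonneg_left hcon' (by linarith)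
        linarith
      have h6 := hd.triangle (Sum.inl 1) (Sum.inr ((1 : G) : G ⧸ H)) p
      have h7 := hcone 1 H.one_mem
      have h8 := hd.nonneg z r
      rw [hcon] at hz h8
      rw [hd.comm (Sum.inr ((1 : G) : G ⧸ H)) p] at h6
      linarith
  obtain ⟨r, hr1, hr2, hr3⟩ := hr
  -- A cone point of `H` between `r` and `h` would be strictly nearer to `v` than `hφk` permits.
  have hjoin₂ : JoinedAvoiding S H ⌊2 * (1 + (2 * C * T + 2 * C) + M)⌋₊ r (Sum.inl h) := by
    refine (joinedAvoiding_of_between hS.2 ?_).mono (Nat.floor_le_floor ?_)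
    · intro z hz hcon
      have h1 := hd.triangle z r v
      have h2 := hd.nonneg z (Sum.inl h)
      have h3 := hd.comm r (Sum.inl h)
      have h4 := hd.comm r z
      rw [hcon] at hz h1 h2 h4
      linarith
    · have h1 := hd.triangle r p (Sum.inl h)
      have h2 := hd.triangle p (Sum.inl 1) (Sum.inl h)
      have h3 := hd.comm r p
      have h4 := hd.comm p (Sum.inl 1)
      linarith
  obtain ⟨w, hw, hw'⟩ := (hjoin₁.trans hr3).trans hjoin₂
  refine hD 1 h rfl ?_ w hw hw'
  rw [eq_comm, QuotientGroup.eq]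
  simpa using hh

/-- A geodesic from the cone point of `H` to another cone point leaves `H` at an element
of `H`. -/
theorem exists_exit (hS : Subgroup.closure S = ⊤) {k : G} (hk : k ∉ H) : ∃ h ∈ H,
    conedOffDist S H (Sum.inr ((1 : G) : G ⧸ H)) (Sum.inr (k : G ⧸ H)) =
      1 / 2 + conedOffDist S H (Sum.inl h) (Sum.inr (k : G ⧸ H)) := by
  obtain ⟨γ, -, hγ⟩ := exists_geodesic_walk hS (Sum.inr ((1 : G) : G ⧸ H))
    (Sum.inr (k : G ⧸ H))
  have hpos : 0 < γ.length := by
    rw [Nat.pos_iff_ne_zero]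
    intro h0
    have h1 := Sum.inr_injective (Walk.eq_of_length_eq_zero h0)
    rw [QuotientGroup.eq] at h1
    exact hk (by simpa using h1)
  have hadj := γ.adj_getVert_succ hpos
  have hadd := hγ.add 0 1 γ.length (by omega) hpos le_rfl
  rw [γ.getVert_length] at hadd
  rw [zero_add] at hadj
  rw [γ.getVert_zero] at hadj hadd
  rcases h1 : γ.getVert 1 with h | c
  · rw [h1] at hadj hadd
    have hh : (h : G ⧸ H) = ((1 : G) : G ⧸ H) := hadj
    refine ⟨h, ?_, ?_⟩
    · rw [eq_comm, QuotientGroup.eq] at hh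
      simpa using hh
    · have h2 := conedOffDist_le_edgeLength hadj
      have h3 := half_le_conedOffDist hS hadj.ne
      simp only [edgeLength] at h2
      linarith
  · rw [h1] at hadj
    exact absurd hadj id

end Exits

/-! ### The normalized section and hyperbolicity of the quotient -/

section Sections

variable {K G Q : Type*} [Group K] [Group G] [Group Q]

/-- A section of an epimorphism is a quasi-isometric embedding if multiplication by elements of
the quotient changes its values by elements of finite sets. -/
theorem isQuasiIsometricEmbedding_of_section {A B : Type*} [Group A] [Group B] (π : B →* A)
    (s : A → B) (hs : ∀ a, π (s a) = a)
    (hfin : ∀ a, {b | ∃ x, b = (s x)⁻¹ * s (x * a)}.Finite) {SA : Set A} {SB : Set B}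
    (hA : IsFiniteGeneratingSet SA) (hB : IsFiniteGeneratingSet SB) :
    IsQuasiIsometricEmbedding (wordDist SA) (wordDist SB) s := by
  obtain ⟨C₁, hC₁, h₁⟩ := exists_wordDist_le hA hB.2 s fun a _ => hfin a
  obtain ⟨C₂, hC₂, h₂⟩ := exists_wordDist_map_le hB hA.2 π
  have hdA := isDiscreteGeodesicMetric_wordDist hA.2
  have hdB := isDiscreteGeodesicMetric_wordDist hB.2
  have hR : 1 ≤ max C₁ C₂ := hC₁.trans (le_max_left _ _)
  refine ⟨max C₁ C₂, 0, hR, le_rfl, fun x x' => ⟨?_, ?_⟩⟩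
  · have h3 := h₂ (s x) (s x')
    rw [hs, hs] at h3
    have h4 := mul_le_mul_of_nonneg_right (le_max_right C₁ C₂) (hdB.nonneg (s x) (s x'))
    rw [sub_zero, one_div, inv_mul_le_iff₀ (by linarith)]
    exact h3.trans h4
  · have h4 := mul_le_mul_of_nonneg_right (le_max_left C₁ C₂) (hdA.nonneg x x')
    linarith [h₁ x x']

/-- If a section as in `isQuasiIsometricEmbedding_of_section` exists and the total group is weakly
hyperbolic relative to a subgroup of the kernel, the quotient is hyperbolic. -/
theorem IsWeaklyHyperbolicRel.isHyperbolicGroup_of_section {A B : Type*} [Group A] [Group B]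
    [Group.FG A] (π : B →* A) (s : A → B) (hs : ∀ a, π (s a) = a)
    (hfin : ∀ a, {b | ∃ x, b = (s x)⁻¹ * s (x * a)}.Finite) {H : Subgroup B} (hH : H ≤ π.ker)
    (h : IsWeaklyHyperbolicRel H) : IsHyperbolicGroup A := by
  obtain ⟨S, hS, hhyp⟩ := h
  refine ⟨inferInstance, fun SA hSA => ?_⟩
  obtain ⟨C₁, hC₁, h₁⟩ := exists_wordDist_le hSA hS.2 s fun a _ => hfin a
  obtain ⟨C₂, hC₂, h₂⟩ := exists_wordDist_map_le hS hSA.2 π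
  have hdA := isDiscreteGeodesicMetric_wordDist hSA.2
  have hd := isDiscreteGeodesicMetric_conedOffDist (H := H) hS.2
  have hR : 1 ≤ max C₁ C₂ := hC₁.trans (le_max_left _ _)
  -- `π` is constant on cosets of `H`, so it extends to cone points and collapses cone edges; the
  -- extension remains Lipschitz and gives the lower bound for `s`.
  have hout : ∀ (g : B) (c : B ⧸ H), (g : B ⧸ H) = c → π g = π c.out := by
    intro g c hc
    have h3 : (g : B ⧸ H) = (c.out : B) := hc.trans (QuotientGroup.out_eq' c).symm
    rw [QuotientGroup.eq] at h3
    have h4 := MonoidHom.mem_ker.1 (hH h3)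
    rwa [map_mul, map_inv, inv_mul_eq_one] at h4
  have hproj := le_mul_conedOffDist (H := H) (C := C₂) hdA.self hdA.triangle hS.2
    (Sum.elim π fun c => π c.out) (by
      intro u v huv
      have h0 : 0 ≤ C₂ * edgeLength u v := by
        have := half_le_edgeLength u v
        apply mul_nonneg <;> linarith
      rcases u with g | c <;> rcases v with g' | c'
      · have e : (SimpleGraph.mulCayley S).Adj g g' := huv
        have h3 := h₂ g g'
        simp only [Sum.elim_inl, edgeLength]
        unfold wordDist at h3 ⊢
        rwa [SimpleGraph.dist_eq_one_iff_adj.2 e, Nat.cast_one] at h3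
      · simp only [Sum.elim_inl, Sum.elim_inr]
        rwa [hout g c' huv, hdA.self]
      · simp only [Sum.elim_inl, Sum.elim_inr]
        rwa [hout g' c huv, hdA.self]
      · exact absurd huv id)
  refine IsGromovHyperbolic.of_quasiIsometricEmbedding hdA hd hhyp hR (f := fun q => Sum.inl (s q))
    (fun x y => ?_) fun x y => ?_
  · have h3 := (conedOffDist_inl_le_wordDist (H := H) hS.2 (s x) (s y)).trans (h₁ x y)
    have h4 := mul_le_mul_of_nonneg_right (le_max_left C₁ C₂) (hdA.nonneg x y)
    linarith
  · have h3 := hproj (Sum.inl (s x)) (Sum.inl (s y))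
    simp only [Sum.elim_inl, hs] at h3
    have h4 := mul_le_mul_of_nonneg_right (le_max_right C₁ C₂)
      (hd.nonneg (Sum.inl (s x)) (Sum.inl (s y)))
    linarith

variable {E : GroupExtension K G Q} {K₁ : Subgroup K}

/-- Correct any lift `g` by an element `k` of the kernel whose conjugation moves `K₁` as `g` does.
-/
theorem PreservesCusps.exists_mem_cuspNormalizer (hcusp : PreservesCusps E K₁) (q : Q) :
    ∃ g ∈ cuspNormalizer E K₁, E.rightHom g = q := by
  obtain ⟨g, rfl⟩ := E.rightHom_surjective q
  obtain ⟨k, hk⟩ := hcusp g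
  refine ⟨(E.inl k)⁻¹ * g, ?_, by simp⟩
  rw [Subgroup.mem_normalizer_iff]
  intro x
  have h1 : ∀ a : G, ∀ y, y ∈ (K₁.map E.inl).map (MulAut.conj a).toMonoidHom ↔
      a⁻¹ * y * a ∈ K₁.map E.inl := by
    intro a y
    rw [Subgroup.mem_map]
    constructor
    · rintro ⟨z, hz, rfl⟩
      simpa [mul_assoc] using hz
    · intro h
      exact ⟨_, h, by simp [mul_assoc]⟩
  have h2 := h1 g (g * x * g⁻¹)
  rw [hk, h1] at h2
  simpa [mul_assoc] using h2.symm

theorem conjAct_mem_iff {g : G} (hg : g ∈ cuspNormalizer E K₁) (k : K) :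
    E.conjAct g k ∈ K₁ ↔ k ∈ K₁ := by
  have h1 : ∀ k, k ∈ K₁ ↔ E.inl k ∈ K₁.map E.inl := fun k =>
    (Subgroup.mem_map_iff_mem E.inl_injective).symm
  rw [h1, h1 k, E.inl_conjAct_comm]
  exact ((Subgroup.mem_normalizer_iff.1 hg) (E.inl k)).symm

theorem mk_mul_mul_eq {H : Subgroup K} {h : K} (hh : h ∈ H) (x : K) :
    ((x * h : K) : K ⧸ H) = x := by
  rw [eq_comm, QuotientGroup.eq]
  simpa using hh

/-- The strongly relatively hyperbolic kernel provides a section over the quotient with values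
in the normalizer of the cusp subgroup, which changes under multiplication by elements of finite
sets. -/
theorem exists_section_finite (hproper : K₁ ≠ ⊤)
    (hinter : K₁.map E.inl = cuspNormalizer E K₁ ⊓ E.rightHom.ker)
    (hK : IsStronglyHyperbolicRel K₁) (hcusp : PreservesCusps E K₁) :
    ∃ s : Q → cuspNormalizer E K₁, (∀ q, E.rightHom (s q : G) = q) ∧
      ∀ a, {b | ∃ x, b = (s x)⁻¹ * s (x * a)}.Finite := by
  obtain ⟨S, hS, hhyp, hB⟩ := hK
  obtain ⟨k₀, hk₀⟩ : ∃ k₀, k₀ ∉ K₁ := by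
    by_contra! hcon
    exact hproper (eq_top_iff.2 fun k _ => hcon k)
  set v₀ : K ⊕ K ⧸ K₁ := Sum.inr ((1 : K) : K ⧸ K₁)
  -- translation of the exit points by elements of the cusp subgroup
  have htrans : ∀ h ∈ K₁, ∀ y x : K,
      conedOffDist S K₁ v₀ (Sum.inr (x : K ⧸ K₁)) =
        1 / 2 + conedOffDist S K₁ (Sum.inl y) (Sum.inr (x : K ⧸ K₁)) →
      conedOffDist S K₁ v₀ (Sum.inr ((h * x : K) : K ⧸ K₁)) =
        1 / 2 + conedOffDist S K₁ (Sum.inl (h * y)) (Sum.inr ((h * x : K) : K ⧸ K₁)) := by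
    intro h hh y x hx
    rw [conedOffDist_mul_left_inl_inr hS.2, ← hx]
    have h1 := conedOffDist_mul_left_inr_inr (H := K₁) hS.2 h 1 x
    rwa [show ((h * 1 : K) : K ⧸ K₁) = ((1 : K) : K ⧸ K₁) by
      rw [← mk_mul_mul_eq hh 1, mul_one, one_mul]] at h1
  have hexit : ∀ q, ∃ g : cuspNormalizer E K₁, E.rightHom (g : G) = q ∧
      conedOffDist S K₁ v₀ (Sum.inr (E.conjAct (g : G) k₀ : K ⧸ K₁)) =
        1 / 2 + conedOffDist S K₁ (Sum.inl 1) (Sum.inr (E.conjAct (g : G) k₀ : K ⧸ K₁)) := by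
    intro q
    obtain ⟨g, hg, rfl⟩ := hcusp.exists_mem_cuspNormalizer q
    obtain ⟨h, hh, hex⟩ := exists_exit hS.2 (fun hmem => hk₀ ((conjAct_mem_iff hg k₀).1 hmem))
    have hhN : (E.inl h)⁻¹ ∈ cuspNormalizer E K₁ :=
      inv_mem (Subgroup.le_normalizer (Subgroup.mem_map_of_mem E.inl hh))
    -- Conjugation by `h⁻¹` translates the moved coset by `h⁻¹`, as the right factor `h` is absorbed
    -- by `K₁`; the exit point `h` is thereby translated to `1`.
    refine ⟨⟨(E.inl h)⁻¹ * g, mul_mem hhN hg⟩, by simp, ?_⟩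
    have h1 : E.conjAct ((E.inl h)⁻¹ * g) k₀ = h⁻¹ * E.conjAct g k₀ * h := by
      apply E.inl_injective
      rw [E.inl_conjAct_comm]
      simp only [map_mul, map_inv, E.inl_conjAct_comm]
      group
    have h2 := htrans h⁻¹ (inv_mem hh) h _ hex
    rw [inv_mul_cancel] at h2
    dsimp only
    rw [h1, mk_mul_mul_eq hh]
    exact h2
  choose t ht1 ht2 using hexit
  have hfin : ∀ a, {b | ∃ x, b = t (a * x) * (t x)⁻¹}.Finite := by
    intro a
    obtain ⟨α, hα, hαa⟩ := hcusp.exists_mem_cuspNormalizer a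
    obtain ⟨D, hD⟩ := exists_wordDist_le_of_exit hS hhyp hB
      (φ := E.conjAct α) (fun k => conjAct_mem_iff hα k)
    have hF := (finite_wordDist_le hS D).image (fun k : K => E.inl k⁻¹ * α)
    refine (hF.preimage (f := Subtype.val) Subtype.val_injective.injOn).subset ?_
    rintro b ⟨x, rfl⟩
    -- The product normalizes `K₁` and lies over `1`; exactness on the normalizer places it in `K₁`.
    have hmem : (t (a * x) : G) * (t x : G)⁻¹ * α⁻¹ ∈ K₁.map E.inl := by
      rw [hinter]
      refine ⟨(t (a * x) * (t x)⁻¹ * ⟨α, hα⟩⁻¹).2, ?_⟩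
      simp [ht1, hαa]
    obtain ⟨h, hh, hhe⟩ := hmem
    have hta : (t (a * x) : G) = E.inl h * α * t x := by rw [hhe]; group
    refine ⟨h⁻¹, hD (E.conjAct (t x : G) k₀) h⁻¹ (inv_mem hh) (ht2 x) ?_, ?_⟩
    · have h1 : h⁻¹ * E.conjAct (t (a * x) : G) k₀ =
          E.conjAct α (E.conjAct (t x : G) k₀) * h⁻¹ := by
        apply E.inl_injective
        rw [map_mul E.inl, map_inv, E.inl_conjAct_comm, hta]
        simp only [map_mul, map_inv, E.inl_conjAct_comm]
        group
      have h2 := htrans h⁻¹ (inv_mem hh) 1 _ (ht2 (a * x))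
      rw [h1, mk_mul_mul_eq (inv_mem hh), mul_one] at h2
      exact h2
    · simp [hta]
  -- `t` is controlled under left multiplication, whereas edges of the Cayley graph are right
  -- multiplications; inversion on both sides exchanges the two.
  refine ⟨fun q => (t q⁻¹)⁻¹, fun q => by simp [ht1], fun a => ?_⟩
  refine (hfin a⁻¹).inv.subset ?_
  rintro b ⟨x, rfl⟩
  refine Set.mem_inv.2 ⟨x⁻¹, ?_⟩
  simp

end Sections

end RelHyp

end

/-! ### The theorem -/

theorem corollary2p9 {K G Q : Type*} [Group K] [Group G] [Group Q]
    [Group.FG K] [Group.FG G] [Group.FG Q]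
    (E : GroupExtension K G Q) (K₁ : Subgroup K) (Q₁ : Subgroup Q)
    (hK₁ : K₁.FG) (hN : (RelHyp.cuspNormalizer E K₁).FG) (hQ₁ : Q₁.FG)
    (hpair : RelHyp.IsExactOnPairs E K₁ (RelHyp.cuspNormalizer E K₁) Q₁)
    (hproper : K₁ ≠ ⊤)
    (hK : RelHyp.IsStronglyHyperbolicRel K₁)
    (hcusp : RelHyp.PreservesCusps E K₁) :
    Q₁ = ⊤ ∧
    (∃ s : Q → RelHyp.cuspNormalizer E K₁,
      (∀ q : Q, E.rightHom (s q : G) = q) ∧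
      (∀ (SQ : Set Q) (SN : Set (RelHyp.cuspNormalizer E K₁)),
        RelHyp.IsFiniteGeneratingSet SQ → RelHyp.IsFiniteGeneratingSet SN →
        RelHyp.IsQuasiIsometricEmbedding (RelHyp.wordDist SQ) (RelHyp.wordDist SN) s) ∧
      (∀ (SQ : Set Q) (SG : Set G),
        RelHyp.IsFiniteGeneratingSet SQ → RelHyp.IsFiniteGeneratingSet SG →
        RelHyp.IsQuasiIsometricEmbedding (RelHyp.wordDist SQ) (RelHyp.wordDist SG)
          (fun q => (s q : G)))) ∧
    (RelHyp.IsWeaklyHyperbolicRel (K₁.map E.inl) → RelHyp.IsHyperbolicGroup Q) := by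
  obtain ⟨s, hs, hfin⟩ := RelHyp.exists_section_finite hproper hpair.map_inl hK hcusp
  have hfinG : ∀ a, {b : G | ∃ x, b = (s x : G)⁻¹ * s (x * a)}.Finite := by
    intro a
    refine ((hfin a).image Subtype.val).subset ?_
    rintro b ⟨x, rfl⟩
    exact ⟨_, ⟨x, rfl⟩, rfl⟩
  refine ⟨?_, ⟨s, hs, ?_, ?_⟩, ?_⟩
  · rw [← hpair.map_rightHom, eq_top_iff]
    intro q _
    obtain ⟨g, hg, hgq⟩ := hcusp.exists_mem_cuspNormalizer q
    exact ⟨g, hg, hgq⟩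
  · intro SQ SN hSQ hSN
    exact RelHyp.isQuasiIsometricEmbedding_of_section
      (E.rightHom.comp (RelHyp.cuspNormalizer E K₁).subtype) s hs hfin hSQ hSN
  · intro SQ SG hSQ hSG
    exact RelHyp.isQuasiIsometricEmbedding_of_section E.rightHom (fun q => (s q : G)) hs hfinG
      hSQ hSG
  · intro h
    refine h.isHyperbolicGroup_of_section E.rightHom (fun q => (s q : G)) hs hfinG ?_
    rw [hpair.map_inl]
    exact inf_le_right
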